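/- Strictly positive formulas are built from propositional variables $p_0,p_1,\dots$ and $\top$ by the grammar $A ::= p \mid \top \mid (A\land B)\mid \alpha A$, where the modalities $\alpha$ range over the ordinals $\alpha\le\omega$. A sequent is an expression $A\vdash B$ with $A,B$ strictly positive formulas. The calculus $\mathrm{RJ}$ has the following axioms and rules: (1) $A\vdash A$; $A\vdash\top$; if $A\vdash B$ and $B\vdash C$ then $A\vdash C$; (2) $A\land B\vdash A$; $A\land B\vdash B$; if $A\vdash B$ and $A\vdash C$ then $A\vdash B\land C$; (3) if $A\vdash B$ then $\alpha A\vdash\alpha B$; $\alpha\alpha A\vdash\alpha A$; (4) $\alpha\beta A\vdash\beta A$ and $\beta\alpha A\vdash\beta A$ for $\alpha\ge\beta$; (5) $\alpha A\land\beta B\vdash\alpha(A\land\beta B)$ for $\alpha>\beta$. The calculus $\mathrm{RC}$ is obtained from $\mathrm{RJ}$ by adding the axioms $\alpha A\vdash\beta A$ for $\alpha>\beta$. Let $|A|$ denote the number of symbols of the formula $A$ (every variable and every modality counts as one symbol), and let $n$ be the number of distinct modalities that occur in $A$ or in $B$. The model of computation is the random access machine with integer registers, whose instructions (assignment of a constant,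 addition, subtraction, indirect load, indirect store, conditional jump on a positive register, reading an input integer, printing a register) take one step each; the sequent $A\vdash B$ is given as the string of its symbols, every symbol being coded by one integer. Theorem. (i) There is a random access machine that, given a sequent $A\vdash B$, decides whether it is provable in $\mathrm{RJ}$, in $O(|A|^2\cdot|B|)$ steps; in particular, in $O((|A|+|B|)^3)$ steps. (ii) There is a random access machine that, given a sequent $A\vdash B$, decides whether it is provable in $\mathrm{RC}$, in $O(|A|^2\cdot\max(n,1)\cdot|B|)$ steps; in particular, in $O((|A|+|B|)^4)$ steps. The implied constants are absolute. -/

import Mathlib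

/-! ## Strictly positive formulas and the calculi -/

namespace PosLogic

/-- Strictly positive formulas `A ::= p | ⊤ | (A ∧ B) | α A`. The propositional variables are
indexed by `ℕ`; the modalities are the ordinals `α ≤ ω`, that is, the elements of `ℕ∞`, where
the top element stands for `ω`. -/
inductive Formula : Type
  | var (i : ℕ) : Formula
  | top : Formula
  | and (A B : Formula) : Formula
  | dia (α : ℕ∞) (A : Formula) : Formula

/-- Derivability of sequents `A ⊢ B` from the axioms and rules of the calculus RJ together with
the additional axioms `E`. -/
inductive Derives (E : Formula → Formula → Prop) : Formula → Formula → Prop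
  | refl (A : Formula) : Derives E A A
  | top (A : Formula) : Derives E A Formula.top
  | syllogism {A B C : Formula} : Derives E A B → Derives E B C → Derives E A C
  | and_left (A B : Formula) : Derives E (Formula.and A B) A
  | and_right (A B : Formula) : Derives E (Formula.and A B) B
  | and_intro {A B C : Formula} :
      Derives E A B → Derives E A C → Derives E A (Formula.and B C)
  | dia_mono (α : ℕ∞) {A B : Formula} :
      Derives E A B → Derives E (Formula.dia α A) (Formula.dia α B)
  | dia_dia (α : ℕ∞) (A : Formula) :
      Derives E (Formula.dia α (Formula.dia α A)) (Formula.dia α A)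
  | dia_high_low {α β : ℕ∞} (A : Formula) : β ≤ α →
      Derives E (Formula.dia α (Formula.dia β A)) (Formula.dia β A)
  | dia_low_high {α β : ℕ∞} (A : Formula) : β ≤ α →
      Derives E (Formula.dia β (Formula.dia α A)) (Formula.dia β A)
  | dia_and {α β : ℕ∞} (A B : Formula) : β < α →
      Derives E (Formula.and (Formula.dia α A) (Formula.dia β B))
        (Formula.dia α (Formula.and A (Formula.dia β B)))
  | extra {A B : Formula} : E A B → Derives E A B

/-- The instances `α A ⊢ β A`, for `α > β`, of the monotonicity axiom. -/
inductive Monotonicity : Formula → Formula → Prop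
  | intro {α β : ℕ∞} (A : Formula) : β < α →
      Monotonicity (Formula.dia α A) (Formula.dia β A)

/-- `RJ A B` says that the sequent `A ⊢ B` is provable in RJ. -/
def RJ (A B : Formula) : Prop := Derives (fun _ _ => False) A B

/-- `RC A B` says that the sequent `A ⊢ B` is provable in RC, that is, in RJ with the
monotonicity axiom added. -/
def RC (A B : Formula) : Prop := Derives Monotonicity A B

/-- The finite set of the modalities that occur in a formula. -/
def Formula.modalities : Formula → Finset ℕ∞
  | .var _ => ∅
  | .top => ∅
  | .and A B => A.modalities ∪ B.modalities
  | .dia α A => insert α A.modalities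

/-! ## Sequents as strings of symbols -/

/-- The symbols from which sequents are written. -/
inductive Symb : Type
  | var (i : ℕ) : Symb
  | top : Symb
  | and : Symb
  | lpar : Symb
  | rpar : Symb
  | turnstile : Symb
  | dia (α : ℕ∞) : Symb

/-- A formula as a string of symbols, following the grammar `p | ⊤ | (A ∧ B) | α A`. -/
def Formula.symbols : Formula → List Symb
  | .var i => [Symb.var i]
  | .top => [Symb.top]
  | .and A B => [Symb.lpar] ++ A.symbols ++ [Symb.and] ++ B.symbols ++ [Symb.rpar]
  | .dia α A => Symb.dia α :: A.symbols

/-- The length of a formula is its number of symbols; every symbol has size one. -/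
def Formula.length (A : Formula) : ℕ := A.symbols.length

/-- The integer that represents a symbol in a register. Distinct symbols have distinct nonzero
codes: variables have negative codes, the modality `ω` has code 6 and the modality `n < ω` has
code `n + 7`. -/
noncomputable def Symb.code : Symb → ℤ
  | .var i => -((i : ℤ) + 1)
  | .top => 1
  | .and => 2
  | .lpar => 3
  | .rpar => 4
  | .turnstile => 5
  | .dia α => if α = ⊤ then 6 else (α.toNat : ℤ) + 7

/-- The sequent `A ⊢ B` as an input, one integer for each symbol. -/
noncomputable def sequentInput (A B : Formula) : List ℤ :=
  (A.symbols ++ [Symb.turnstile] ++ B.symbols).map Symb.code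

end PosLogic

/-! ## Random access machines -/

namespace RAM

/-- Instructions of a random access machine with registers `X 0, X 1, X 2, …` that hold integers.
-/
inductive Instr : Type
  /-- `X i ← c` -/
  | const (i : ℕ) (c : ℤ) : Instr
  /-- `X i ← X j + X k` -/
  | add (i j k : ℕ) : Instr
  /-- `X i ← X j - X k` -/
  | sub (i j k : ℕ) : Instr
  /-- `X i ← X (X j)` -/
  | load (i j : ℕ) : Instr
  /-- `X (X i) ← X j` -/
  | store (i j : ℕ) : Instr
  /-- transfer control to line `m` if `X j > 0` -/
  | jump (m j : ℕ) : Instr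
  /-- read the next input integer into `X i`; past the end of the input, the integer read is 0 -/
  | read (i : ℕ) : Instr
  /-- print the content of `X i` -/
  | print (i : ℕ) : Instr

/-- A program is a finite list of instructions, with lines numbered from 0. -/
abbrev Program : Type := List Instr

/-- A configuration: the line to be executed next, the contents of the registers, the part of the
input not yet read, and the output printed so far. -/
structure Config : Type where
  pc : ℕ
  reg : ℕ → ℤ
  inp : List ℤ
  out : List ℤ

/-- The effect of one instruction. Indirect addressing with a negative address is an error, and
then there is no next configuration. -/
def Instr.exec (I : Instr) (c : Config) : Option Config :=
  match I with
  | .const i a => some { c with pc := c.pc + 1, reg := Function.update c.reg i a }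
  | .add i j k =>
      some { c with pc := c.pc + 1, reg := Function.update c.reg i (c.reg j + c.reg k) }
  | .sub i j k =>
      some { c with pc := c.pc + 1, reg := Function.update c.reg i (c.reg j - c.reg k) }
  | .load i j =>
      if 0 ≤ c.reg j then
        some { c with pc := c.pc + 1, reg := Function.update c.reg i (c.reg (c.reg j).toNat) }
      else none
  | .store i j =>
      if 0 ≤ c.reg i then
        some { c with pc := c.pc + 1, reg := Function.update c.reg (c.reg i).toNat (c.reg j) }
      else none
  | .jump m j => some { c with pc := if 0 < c.reg j then m else c.pc + 1 }
  | .read i =>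
      some { c with
        pc := c.pc + 1
        reg := Function.update c.reg i (c.inp.headD 0)
        inp := c.inp.tail }
  | .print i => some { c with pc := c.pc + 1, out := c.out ++ [c.reg i] }

/-- One step of a program; there is none if the current line lies outside the program. -/
def step (P : Program) (c : Config) : Option Config :=
  (P[c.pc]?).bind fun I => I.exec c

/-- The configuration after `t` steps from `c`, if there are that many. -/
def run (P : Program) (c : Config) : ℕ → Option Config
  | 0 => some c
  | t + 1 => (run P c t).bind (step P)

/-- The initial configuration: line 0, all registers 0, nothing printed. -/
def start (x : List ℤ) : Config where
  pc := 0
  reg := fun _ => 0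
  inp := x
  out := []

/-- On input `x`, the program halts after exactly `t` steps, by leaving the range of its lines,
with output `y`. -/
def HaltsWith (P : Program) (x : List ℤ) (t : ℕ) (y : List ℤ) : Prop :=
  ∃ c, run P (start x) t = some c ∧ P.length ≤ c.pc ∧ c.out = y

/-- The program decides the relation `R` between formulas, given as sequents, in time `T`: on
input `A ⊢ B` it halts after at most `T A B` steps, with output 1 if `R A B` and 0 otherwise. -/
def DecidesInTime (P : Program) (R : PosLogic.Formula → PosLogic.Formula → Prop)
    (T : PosLogic.Formula → PosLogic.Formula → ℕ) : Prop :=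
  ∀ A B : PosLogic.Formula, ∃ t ≤ T A B,
    (R A B → HaltsWith P (PosLogic.sequentInput A B) t [1]) ∧
    (¬ R A B → HaltsWith P (PosLogic.sequentInput A B) t [0])

end RAM

/-! A strictly positive formula `A` is read as a finite tree: each occurrence of a modality creates
a child of the current node with that label, and each variable is recorded at the node where it is
read. The relation `Tree.Rel` for `β` closes this tree under the axioms: climb edges with labels
greater than `β`, then descend along at least one edge, all labels being at least `β`. In RJ one of
the descending edges must be labelled exactly `β`; in RC any edge will do.

`Reader.prov_iff_sat` says that `A ⊢ B` is provable iff `B` holds at the root. Soundness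
(`Tree.sat_of_prov`) rests on the frame conditions `Rel.high_low`, `Rel.low_high`, `Rel.eucl` and
`Rel.mono`; the first three hold because the path from a node towards the root is unique. For
completeness, `Reader.exists_isFamily_foldl` gives every node a theory: the root gets the
consequences of `A`, and a new child with label `α` gets the consequences of the formula read there
together with the formulas `β C`, `β < α`, in the theory of its parent. By `IsFamily.of_sat` every
formula true at a node lies in its theory.

The closure is never computed. The truth set of `β C` arises from that of `C` by three local
recursions (`WF.rel_of_equations`). Parents have smaller numbers than their children, so one pass
from the leaves to the root and one pass back solve them. Reading `B` from right to left turns it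
into a program on a stack of truth vectors, in which each symbol costs time linear in the size of
the tree. The total is O(|A|·|B|), which lies below all the required bounds. The number of
modalities does not matter, since labels are compared in constant time.

The algorithm is written in a small structured language. `Exec.simulate` compiles it with slowdown
at most 8, and `Wp` with the rule `wp_while` proves correctness and running time together. -/

namespace RAM

/-! ## A structured language on top of random access machines -/

/-- Scalar variables. -/
inductive Var : Type
  | zero | one | five | seven | n | cur | sp | f | c | d | go | m | top | base | i | j | k | l | r | p | g
  deriving DecidableEq

/-- Array variables. -/
inductive Arr : Type
  | fv | fn | par | lab | stk | inb | vec | er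
  deriving DecidableEq

theorem Var.ctorIdx_injective {v w : Var} (h : v.ctorIdx = w.ctorIdx) : v = w := by
  cases v <;> cases w <;> first | rfl | (simp [Var.ctorIdx] at h)

theorem Arr.ctorIdx_injective {v w : Arr} (h : v.ctorIdx = w.ctorIdx) : v = w := by
  cases v <;> cases w <;> first | rfl | (simp [Arr.ctorIdx] at h)

theorem Arr.ctorIdx_lt (v : Arr) : v.ctorIdx < 8 := by
  cases v <;> simp [Arr.ctorIdx]

/-- States of the structured language. -/
structure St : Type where
  s : Var → ℤ
  a : Arr → ℕ → ℤ
  inp : List ℤ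
  out : List ℤ

/-- Assignment to a scalar. -/
def St.set (σ : St) (v : Var) (x : ℤ) : St := { σ with s := Function.update σ.s v x }

/-- Assignment to an array entry. -/
def St.put (σ : St) (k : Arr) (i : ℕ) (x : ℤ) : St :=
  { σ with a := Function.update σ.a k (Function.update (σ.a k) i x) }

@[simp] theorem St.set_s (σ : St) (v w : Var) (x : ℤ) :
    (σ.set v x).s w = if w = v then x else σ.s w := by
  simp [St.set, Function.update_apply]

@[simp] theorem St.set_a (σ : St) (v : Var) (x : ℤ) : (σ.set v x).a = σ.a := rfl
@[simp] theorem St.set_inp (σ : St) (v : Var) (x : ℤ) : (σ.set v x).inp = σ.inp := rfl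
@[simp] theorem St.set_out (σ : St) (v : Var) (x : ℤ) : (σ.set v x).out = σ.out := rfl
@[simp] theorem St.put_s (σ : St) (k : Arr) (i : ℕ) (x : ℤ) : (σ.put k i x).s = σ.s := rfl

@[simp] theorem St.put_a_self (σ : St) (k : Arr) (i j : ℕ) (x : ℤ) :
    (σ.put k i x).a k j = if j = i then x else σ.a k j := by
  simp [St.put, Function.update_apply]

@[simp] theorem St.put_a_ne (σ : St) (k k' : Arr) (i : ℕ) (x : ℤ) (h : k' ≠ k) :
    (σ.put k i x).a k' = σ.a k' := by
  simp [St.put, h]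

/-- Structured programs. -/
inductive Stmt : Type
  | skip : Stmt
  | const (v : Var) (x : ℤ) : Stmt
  | add (v w u : Var) : Stmt
  | sub (v w u : Var) : Stmt
  | get (v : Var) (k : Arr) (w : Var) : Stmt
  | put (k : Arr) (w v : Var) : Stmt
  | read (v : Var) : Stmt
  | print (v : Var) : Stmt
  | seq (S T : Stmt) : Stmt
  | ite (v : Var) (S T : Stmt) : Stmt
  | while (v : Var) (S : Stmt) : Stmt

/-- `Exec S σ σ' t`: the program `S` leads from `σ` to `σ'` in time `t`. -/
inductive Exec : Stmt → St → St → ℕ → Prop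
  | skip (σ : St) : Exec .skip σ σ 0
  | const (σ : St) (v : Var) (x : ℤ) : Exec (.const v x) σ (σ.set v x) 1
  | add (σ : St) (v w u : Var) : Exec (.add v w u) σ (σ.set v (σ.s w + σ.s u)) 1
  | sub (σ : St) (v w u : Var) : Exec (.sub v w u) σ (σ.set v (σ.s w - σ.s u)) 1
  | get (σ : St) (v : Var) (k : Arr) (w : Var) : 0 ≤ σ.s w →
      Exec (.get v k w) σ (σ.set v (σ.a k (σ.s w).toNat)) 1
  | put (σ : St) (k : Arr) (w v : Var) : 0 ≤ σ.s w →
      Exec (.put k w v) σ (σ.put k (σ.s w).toNat (σ.s v)) 1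
  | read (σ : St) (v : Var) :
      Exec (.read v) σ { σ.set v (σ.inp.headD 0) with inp := σ.inp.tail } 1
  | print (σ : St) (v : Var) : Exec (.print v) σ { σ with out := σ.out ++ [σ.s v] } 1
  | seq {S T : Stmt} {σ₁ σ₂ σ₃ : St} {t₁ t₂ : ℕ} : Exec S σ₁ σ₂ t₁ → Exec T σ₂ σ₃ t₂ →
      Exec (.seq S T) σ₁ σ₃ (t₁ + t₂)
  | ite_pos {v : Var} {S T : Stmt} {σ σ' : St} {t : ℕ} : 0 < σ.s v → Exec S σ σ' t →
      Exec (.ite v S T) σ σ' (t + 1)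
  | ite_neg {v : Var} {S T : Stmt} {σ σ' : St} {t : ℕ} : ¬ 0 < σ.s v → Exec T σ σ' t →
      Exec (.ite v S T) σ σ' (t + 1)
  | while_pos {v : Var} {S : Stmt} {σ₁ σ₂ σ₃ : St} {t₁ t₂ : ℕ} : 0 < σ₁.s v →
      Exec S σ₁ σ₂ t₁ → Exec (.while v S) σ₂ σ₃ t₂ → Exec (.while v S) σ₁ σ₃ (t₁ + t₂ + 1)
  | while_neg {v : Var} {S : Stmt} {σ : St} : ¬ 0 < σ.s v → Exec (.while v S) σ σ 1

/-! ### Compilation -/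

/-- The register of a scalar. The registers `0` and `16` are scratch registers. -/
def Var.reg (v : Var) : ℕ := 16 * v.ctorIdx + 1

/-- The register of an array entry. -/
def Arr.reg (k : Arr) (i : ℕ) : ℕ := 16 * i + (k.ctorIdx + 2)

/-- Code that puts the register number of an array entry into register `0`. -/
def addressCode (k : Arr) (w : Var) : List Instr :=
  [.add 0 w.reg w.reg, .add 0 0 0, .add 0 0 0, .add 0 0 0, .const 16 (k.ctorIdx + 2 : ℕ),
    .add 0 0 16]

/-- The code of a structured program, to be placed from line `o` on. -/
def Stmt.compile : Stmt → ℕ → List Instr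
  | .skip, _ => []
  | .const v x, _ => [.const v.reg x]
  | .add v w u, _ => [.add v.reg w.reg u.reg]
  | .sub v w u, _ => [.sub v.reg w.reg u.reg]
  | .get v k w, _ => addressCode k w ++ [.load v.reg 0]
  | .put k w v, _ => addressCode k w ++ [.store 0 v.reg]
  | .read v, _ => [.read v.reg]
  | .print v, _ => [.print v.reg]
  | .seq S T, o => S.compile o ++ T.compile (o + (S.compile o).length)
  | .ite v S T, o =>
      [.jump (o + 1 + (T.compile (o + 1)).length + 2) v.reg] ++ T.compile (o + 1) ++
      [.const 16 1, .jump (o + 1 + (T.compile (o + 1)).length + 2 +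
        (S.compile (o + 1 + (T.compile (o + 1)).length + 2)).length) 16] ++
      S.compile (o + 1 + (T.compile (o + 1)).length + 2)
  | .while v S, o =>
      [.jump (o + 3) v.reg, .const 16 1, .jump (o + 3 + (S.compile (o + 3)).length + 2) 16] ++
      S.compile (o + 3) ++ [.const 16 1, .jump o 16]

/-- The program `P` has the code `l` from line `o` on. -/
def CodeAt (P : Program) : ℕ → List Instr → Prop
  | _, [] => True
  | o, I :: l => P[o]? = some I ∧ CodeAt P (o + 1) l

theorem codeAt_append {P : Program} {o : ℕ} {l₁ l₂ : List Instr} :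
    CodeAt P o (l₁ ++ l₂) ↔ CodeAt P o l₁ ∧ CodeAt P (o + l₁.length) l₂ := by
  induction l₁ generalizing o with
  | nil => simp [CodeAt]
  | cons I l ih =>
    simp only [List.cons_append, CodeAt, ih, List.length_cons, and_assoc]
    rw [show o + 1 + l.length = o + (l.length + 1) by omega]

theorem codeAt_drop (P : Program) (o : ℕ) : CodeAt P o (P.drop o) := by
  by_cases h : o < P.length
  · have := codeAt_drop P (o + 1)
    rw [List.drop_eq_getElem_cons h]
    exact ⟨by simp [h], this⟩
  · rw [List.drop_eq_nil_of_le (by omega)]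
    trivial
  termination_by P.length - o

/-- The definition of `run` splits off the last step, while simulation proofs follow the code from
its first instruction. -/
theorem run_succ (P : Program) (c : Config) (t : ℕ) :
    run P c (t + 1) = (step P c).bind fun c' => run P c' t := by
  induction t with
  | zero => cases h : step P c <;> simp [run, h]
  | succ t ih =>
    rw [run, ih]
    cases h : step P c <;> simp [run]

theorem run_add (P : Program) (c : Config) (s t : ℕ) :
    run P c (s + t) = (run P c s).bind fun c' => run P c' t := by
  induction t with
  | zero => simp [run]
  | succ t ih => rw [← add_assoc, run, ih, Option.bind_assoc]; rfl

theorem run_trans {P : Program} {c₁ c₂ c₃ : Config} {s t : ℕ} (h₁ : run P c₁ s = some c₂)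
    (h₂ : run P c₂ t = some c₃) : run P c₁ (s + t) = some c₃ := by
  simp [run_add, h₁, h₂]

theorem run_cons {P : Program} {c c₁ c₂ : Config} {I : Instr} {t : ℕ} (hI : P[c.pc]? = some I)
    (h₁ : I.exec c = some c₁) (h₂ : run P c₁ t = some c₂) : run P c (t + 1) = some c₂ := by
  simp [run_succ, step, hI, h₁, h₂]

theorem exec_jump_pos {c : Config} {m j : ℕ} (h : 0 < c.reg j) :
    (Instr.jump m j).exec c = some { c with pc := m } := by
  simp [Instr.exec, h]

theorem exec_jump_neg {c : Config} {m j : ℕ} (h : ¬ 0 < c.reg j) :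
    (Instr.jump m j).exec c = some { c with pc := c.pc + 1 } := by
  simp [Instr.exec, h]

/-- The configuration `c` represents the state `σ`. -/
structure Represents (c : Config) (σ : St) : Prop where
  scalar : ∀ v, c.reg v.reg = σ.s v
  array : ∀ k i, c.reg (Arr.reg k i) = σ.a k i
  inp : c.inp = σ.inp
  out : c.out = σ.out

theorem Var.reg_inj {v w : Var} : v.reg = w.reg ↔ v = w :=
  ⟨fun h => Var.ctorIdx_injective (by simp only [Var.reg] at h; omega), fun h => h ▸ rfl⟩

theorem Arr.reg_inj {k k' : Arr} {i i' : ℕ} : k.reg i = k'.reg i' ↔ k = k' ∧ i = i' := by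
  refine ⟨fun h => ?_, fun h => by rw [h.1, h.2]⟩
  have h₁ := k.ctorIdx_lt
  have h₂ := k'.ctorIdx_lt
  simp only [Arr.reg] at h
  exact ⟨Arr.ctorIdx_injective (by omega), by omega⟩

/-- Modulo 16, scalars occupy the residue 1, the eight arrays the residues 2 to 9, and the scratch
registers the residue 0. -/
theorem Arr.reg_ne_var (k : Arr) (i : ℕ) (v : Var) : k.reg i ≠ v.reg := by
  have h₁ := k.ctorIdx_lt
  simp only [Arr.reg, Var.reg]
  omega

theorem Var.reg_ne_scratch (v : Var) : v.reg ≠ 0 ∧ v.reg ≠ 16 := by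
  simp only [Var.reg]
  omega

theorem Arr.reg_ne_scratch (k : Arr) (i : ℕ) : k.reg i ≠ 0 ∧ k.reg i ≠ 16 := by
  have h₁ := k.ctorIdx_lt
  simp only [Arr.reg]
  omega

theorem Represents.update_scalar {c : Config} {σ : St} (h : Represents c σ) (v : Var) (x : ℤ)
    (pc : ℕ) :
    Represents { c with pc := pc, reg := Function.update c.reg v.reg x } (σ.set v x) where
  scalar w := by simp [Function.update_apply, Var.reg_inj, h.scalar]
  array k i := by simp [Arr.reg_ne_var, h.array]
  inp := h.inp
  out := h.out

theorem Represents.update_array {c : Config} {σ : St} (h : Represents c σ) (k : Arr) (i : ℕ)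
    (x : ℤ) (pc : ℕ) :
    Represents { c with pc := pc, reg := Function.update c.reg (k.reg i) x } (σ.put k i x) where
  scalar w := by simp [(Arr.reg_ne_var _ _ _).symm, h.scalar]
  array k' i' := by
    by_cases hk : k' = k
    · subst hk; simp [Function.update_apply, Arr.reg_inj, h.array]
    · simp [Arr.reg_inj, hk, h.array]
  inp := h.inp
  out := h.out

theorem Represents.update_scratch {c : Config} {σ : St} (h : Represents c σ) {q : ℕ}
    (hq : q = 0 ∨ q = 16) (x : ℤ) (pc : ℕ) :
    Represents { c with pc := pc, reg := Function.update c.reg q x } σ where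
  scalar w := by
    have := w.reg_ne_scratch
    rw [← h.scalar w]
    exact Function.update_of_ne (by rcases hq with rfl | rfl; exacts [this.1, this.2]) _ _
  array k i := by
    have := k.reg_ne_scratch i
    rw [← h.array k i]
    exact Function.update_of_ne (by rcases hq with rfl | rfl; exacts [this.1, this.2]) _ _
  inp := h.inp
  out := h.out

theorem Represents.goto {c : Config} {σ : St} (h : Represents c σ) (pc : ℕ) :
    Represents { c with pc := pc } σ := ⟨h.scalar, h.array, h.inp, h.out⟩

theorem run_addressCode {P : Program} {c : Config} {σ : St} {k : Arr} {w : Var}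
    (hP : CodeAt P c.pc (addressCode k w)) (h : Represents c σ) (hw : 0 ≤ σ.s w) :
    ∃ c', run P c 6 = some c' ∧ c'.pc = c.pc + 6 ∧ Represents c' σ ∧
      c'.reg 0 = (k.reg (σ.s w).toNat : ℕ) := by
  obtain ⟨h₁, h₂, h₃, h₄, h₅, h₆, -⟩ := hP
  refine ⟨_, run_cons h₁ rfl <| run_cons h₂ rfl <| run_cons h₃ rfl <| run_cons h₄ rfl <|
    run_cons h₅ rfl <| run_cons h₆ rfl rfl, rfl, ?_, ?_⟩
  · exact (((((h.update_scratch (.inl rfl) _ _).update_scratch (.inl rfl) _ _).update_scratch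
      (.inl rfl) _ _).update_scratch (.inl rfl) _ _).update_scratch (.inr rfl) _ _).update_scratch
      (.inl rfl) _ _
  -- Four doublings produce the factor 16 of `Arr.reg`.
  · have := h.scalar w
    simp only [Function.update_self, this, Arr.reg, Function.update_of_ne (show (0 : ℕ) ≠ 16 by decide)]
    push_cast
    rw [Int.toNat_of_nonneg hw]
    ring

/-- Compiled code simulates the structured program with a constant slowdown. -/
theorem Exec.simulate {S : Stmt} {σ σ' : St} {t : ℕ} (hS : Exec S σ σ' t) {P : Program} :
    ∀ {c : Config}, CodeAt P c.pc (S.compile c.pc) → Represents c σ →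
    ∃ c' t', t' ≤ 8 * t ∧ run P c t' = some c' ∧ c'.pc = c.pc + (S.compile c.pc).length ∧
      Represents c' σ' := by
  induction hS with
  | skip σ => exact fun hP h => ⟨_, 0, by simp, rfl, rfl, h⟩
  | const σ v x => exact fun hP h => ⟨_, 1, by simp, run_cons hP.1 rfl rfl, rfl, h.update_scalar ..⟩
  | add σ v w u =>
    intro c hP h
    refine ⟨_, 1, by simp, run_cons hP.1 rfl rfl, rfl, ?_⟩
    rw [← h.scalar w, ← h.scalar u]
    exact h.update_scalar ..
  | sub σ v w u =>
    intro c hP h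
    refine ⟨_, 1, by simp, run_cons hP.1 rfl rfl, rfl, ?_⟩
    rw [← h.scalar w, ← h.scalar u]
    exact h.update_scalar ..
  | get σ v k w hw =>
    intro c hP h
    obtain ⟨h₁, h₂⟩ := codeAt_append.1 hP
    obtain ⟨c', hr, hpc, hc', h0⟩ := run_addressCode h₁ h hw
    have hx : (Instr.load v.reg 0).exec c' = some { c' with
        pc := c'.pc + 1, reg := Function.update c'.reg v.reg (σ.a k (σ.s w).toNat) } := by
      simp [Instr.exec, h0, hc'.array]
    -- Six steps compute the address and one accesses it. Array accesses are the costliest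
    -- instructions and stay below the slowdown 8.
    refine ⟨_, 6 + 1, by simp, run_trans hr (run_cons ?_ hx rfl), ?_, hc'.update_scalar ..⟩
    · rw [hpc]; exact h₂.1
    · simp [hpc, Stmt.compile, addressCode]
  | put σ k w v hw =>
    intro c hP h
    obtain ⟨h₁, h₂⟩ := codeAt_append.1 hP
    obtain ⟨c', hr, hpc, hc', h0⟩ := run_addressCode h₁ h hw
    have hx : (Instr.store 0 v.reg).exec c' = some { c' with
        pc := c'.pc + 1, reg := Function.update c'.reg (k.reg (σ.s w).toNat) (σ.s v) } := by
      simp [Instr.exec, h0, hc'.scalar]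
    refine ⟨_, 6 + 1, by simp, run_trans hr (run_cons ?_ hx rfl), ?_, hc'.update_array ..⟩
    · rw [hpc]; exact h₂.1
    · simp [hpc, Stmt.compile, addressCode]
  | read σ v =>
    intro c hP h
    refine ⟨_, 1, by simp, run_cons hP.1 rfl rfl, rfl, ?_⟩
    have := h.update_scalar v (σ.inp.headD 0) (c.pc + 1)
    rw [h.inp]
    exact ⟨this.scalar, this.array, rfl, this.out⟩
  | print σ v =>
    intro c hP h
    refine ⟨_, 1, by simp, run_cons hP.1 rfl rfl, rfl, h.scalar, h.array, h.inp, ?_⟩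
    rw [h.scalar, h.out]
  | @seq S T σ₁ σ₂ σ₃ t₁ t₂ _ _ ih₁ ih₂ =>
    intro c hP h
    obtain ⟨h₁, h₂⟩ := codeAt_append.1 hP
    obtain ⟨c₁, s₁, hs₁, hr₁, hpc₁, hc₁⟩ := ih₁ h₁ h
    rw [← hpc₁] at h₂
    obtain ⟨c₂, s₂, hs₂, hr₂, hpc₂, hc₂⟩ := ih₂ h₂ hc₁
    refine ⟨c₂, s₁ + s₂, by omega, run_trans hr₁ hr₂, ?_, hc₂⟩
    rw [hpc₂, hpc₁, Stmt.compile, List.length_append, add_assoc]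
  | @ite_pos v S T σ σ' t hv _ ih =>
    intro c hP h
    simp only [Stmt.compile, List.append_assoc, codeAt_append] at hP
    obtain ⟨h₁, h₂, h₃, h₄⟩ := hP
    simp only [List.length_cons, List.length_nil, zero_add, Nat.reduceAdd] at h₂ h₃ h₄
    obtain ⟨c₁, s₁, hs₁, hr₁, hpc₁, hc₁⟩ := ih (c := { c with pc := c.pc + 1 + (T.compile (c.pc + 1)).length + 2 }) h₄ (h.goto _)
    refine ⟨c₁, s₁ + 1, by omega, run_cons h₁.1 ?_ hr₁, ?_, hc₁⟩
    · simp [Instr.exec, h.scalar, hv]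
    · rw [hpc₁]
      simp only [Stmt.compile, List.length_append, List.length_cons, List.length_nil]
      omega
  | @ite_neg v S T σ σ' t hv _ ih =>
    intro c hP h
    simp only [Stmt.compile, List.append_assoc, codeAt_append] at hP
    obtain ⟨h₁, h₂, h₃, h₄⟩ := hP
    simp only [List.length_cons, List.length_nil, zero_add, Nat.reduceAdd] at h₂ h₃ h₄
    obtain ⟨c₁, s₁, hs₁, hr₁, hpc₁, hc₁⟩ := ih (c := { c with pc := c.pc + 1 }) h₂ (h.goto _)
    obtain ⟨h₅, h₆, -⟩ := h₃
    rw [show c.pc + 1 + (T.compile (c.pc + 1)).length = c₁.pc from hpc₁.symm] at h₅ h₆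
    refine ⟨_, 1 + (s₁ + 2), by omega, run_trans (run_cons h₁.1
      (exec_jump_neg (by simpa [h.scalar] using hv)) rfl) (run_trans hr₁ (run_cons h₅ rfl
      (run_cons h₆ rfl rfl))), ?_, (hc₁.update_scratch (Or.inr rfl) 1 _).goto _⟩
    simp only [Function.update_self, zero_lt_one, if_true, Stmt.compile, List.length_append,
      List.length_cons, List.length_nil, hpc₁]
    omega
  | @while_pos v S σ₁ σ₂ σ₃ t₁ t₂ hv _ _ ih₁ ih₂ =>
    intro c hP h
    -- The code of the whole loop is needed again after the jump back to its first line.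
    have hP' := hP
    simp only [Stmt.compile, List.append_assoc, codeAt_append] at hP
    obtain ⟨h₁, h₂, h₃⟩ := hP
    simp only [List.length_cons, List.length_nil, zero_add, Nat.reduceAdd] at h₂ h₃
    obtain ⟨c₁, s₁, hs₁, hr₁, hpc₁, hc₁⟩ := ih₁ (c := { c with pc := c.pc + 3 }) h₂ (h.goto _)
    obtain ⟨h₅, h₆, -⟩ := h₃
    rw [show c.pc + 3 + (S.compile (c.pc + 3)).length = c₁.pc from hpc₁.symm] at h₅ h₆
    obtain ⟨c₂, s₂, hs₂, hr₂, hpc₂, hc₂⟩ := ih₂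
      (c := { c₁ with pc := c.pc, reg := Function.update c₁.reg 16 1 }) hP'
      (hc₁.update_scratch (Or.inr rfl) _ _)
    refine ⟨c₂, 1 + (s₁ + (2 + s₂)), by omega, run_trans (run_cons h₁.1
      (exec_jump_pos (by simpa [h.scalar] using hv)) rfl) (run_trans hr₁ (run_trans
      (run_cons h₅ rfl (run_cons h₆ ?_ rfl)) hr₂)), hpc₂, hc₂⟩
    simp [Instr.exec]
  | @while_neg v S σ hv =>
    intro c hP h
    simp only [Stmt.compile, List.append_assoc, codeAt_append] at hP
    obtain ⟨h₁, h₂, h₃⟩ := hP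
    refine ⟨_, 3, by omega, run_cons h₁.1
      (exec_jump_neg (by simpa [h.scalar] using hv)) (run_cons h₁.2.1 rfl
      (run_cons h₁.2.2.1 rfl rfl)), ?_, (h.update_scratch (Or.inr rfl) 1 _).goto _⟩
    simp only [Function.update_self, zero_lt_one, if_true, Stmt.compile, List.length_append,
      List.length_cons, List.length_nil]
    omega

/-- The initial state. -/
def St.init (x : List ℤ) : St := ⟨fun _ => 0, fun _ _ => 0, x, []⟩

/-- The program consists of the compiled code alone, so reaching the end of this code is leaving the
range of the lines. -/
theorem Exec.haltsWith {S : Stmt} {x : List ℤ} {σ : St} {t : ℕ} (h : Exec S (St.init x) σ t) :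
    ∃ t' ≤ 8 * t, HaltsWith (S.compile 0) x t' σ.out := by
  obtain ⟨c, t', ht, hr, hpc, hc⟩ := h.simulate (P := S.compile 0) (c := start x)
    (codeAt_drop _ 0) ⟨fun _ => rfl, fun _ _ => rfl, rfl, rfl⟩
  exact ⟨t', ht, c, hr, by simp [hpc, start], hc.out⟩

/-! ### Reasoning about structured programs -/

/-- The program `S`, started in `σ`, terminates in a state and a time that satisfy `Q`. -/
def Wp (S : Stmt) (σ : St) (Q : St → ℕ → Prop) : Prop := ∃ σ' t, Exec S σ σ' t ∧ Q σ' t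

theorem Wp.mono {S : Stmt} {σ : St} {Q Q' : St → ℕ → Prop} (h : Wp S σ Q)
    (hQ : ∀ σ' t, Q σ' t → Q' σ' t) : Wp S σ Q' := by
  obtain ⟨σ', t, he, hq⟩ := h
  exact ⟨σ', t, he, hQ _ _ hq⟩

@[simp] theorem wp_skip {σ : St} {Q : St → ℕ → Prop} : Wp .skip σ Q ↔ Q σ 0 :=
  ⟨fun ⟨_, _, h, q⟩ => by cases h; exact q, fun q => ⟨_, _, .skip _, q⟩⟩

@[simp] theorem wp_const {σ : St} {Q : St → ℕ → Prop} {v : Var} {x : ℤ} :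
    Wp (.const v x) σ Q ↔ Q (σ.set v x) 1 :=
  ⟨fun ⟨_, _, h, q⟩ => by cases h; exact q, fun q => ⟨_, _, .const .., q⟩⟩

@[simp] theorem wp_add {σ : St} {Q : St → ℕ → Prop} {v w u : Var} :
    Wp (.add v w u) σ Q ↔ Q (σ.set v (σ.s w + σ.s u)) 1 :=
  ⟨fun ⟨_, _, h, q⟩ => by cases h; exact q, fun q => ⟨_, _, .add .., q⟩⟩

@[simp] theorem wp_sub {σ : St} {Q : St → ℕ → Prop} {v w u : Var} :
    Wp (.sub v w u) σ Q ↔ Q (σ.set v (σ.s w - σ.s u)) 1 :=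
  ⟨fun ⟨_, _, h, q⟩ => by cases h; exact q, fun q => ⟨_, _, .sub .., q⟩⟩

@[simp] theorem wp_get {σ : St} {Q : St → ℕ → Prop} {v w : Var} {k : Arr} :
    Wp (.get v k w) σ Q ↔ 0 ≤ σ.s w ∧ Q (σ.set v (σ.a k (σ.s w).toNat)) 1 :=
  ⟨fun ⟨_, _, h, q⟩ => by cases h with | get _ _ _ _ hw => exact ⟨hw, q⟩,
    fun q => ⟨_, _, .get _ _ _ _ q.1, q.2⟩⟩

@[simp] theorem wp_put {σ : St} {Q : St → ℕ → Prop} {v w : Var} {k : Arr} :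
    Wp (.put k w v) σ Q ↔ 0 ≤ σ.s w ∧ Q (σ.put k (σ.s w).toNat (σ.s v)) 1 :=
  ⟨fun ⟨_, _, h, q⟩ => by cases h with | put _ _ _ _ hw => exact ⟨hw, q⟩,
    fun q => ⟨_, _, .put _ _ _ _ q.1, q.2⟩⟩

@[simp] theorem wp_read {σ : St} {Q : St → ℕ → Prop} {v : Var} :
    Wp (.read v) σ Q ↔ Q { σ.set v (σ.inp.headD 0) with inp := σ.inp.tail } 1 :=
  ⟨fun ⟨_, _, h, q⟩ => by cases h; exact q, fun q => ⟨_, _, .read .., q⟩⟩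

@[simp] theorem wp_print {σ : St} {Q : St → ℕ → Prop} {v : Var} :
    Wp (.print v) σ Q ↔ Q { σ with out := σ.out ++ [σ.s v] } 1 :=
  ⟨fun ⟨_, _, h, q⟩ => by cases h; exact q, fun q => ⟨_, _, .print .., q⟩⟩

@[simp] theorem wp_seq {σ : St} {Q : St → ℕ → Prop} {S T : Stmt} :
    Wp (.seq S T) σ Q ↔ Wp S σ fun σ₁ t₁ => Wp T σ₁ fun σ₂ t₂ => Q σ₂ (t₁ + t₂) :=
  ⟨fun ⟨_, _, h, q⟩ => by cases h with | seq h₁ h₂ => exact ⟨_, _, h₁, _, _, h₂, q⟩,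
    fun ⟨_, _, h₁, _, _, h₂, q⟩ => ⟨_, _, .seq h₁ h₂, q⟩⟩

@[simp] theorem wp_ite {σ : St} {Q : St → ℕ → Prop} {v : Var} {S T : Stmt} :
    Wp (.ite v S T) σ Q ↔ if 0 < σ.s v then Wp S σ fun σ' t => Q σ' (t + 1)
      else Wp T σ fun σ' t => Q σ' (t + 1) := by
  split_ifs with hv
  · exact ⟨fun ⟨_, _, h, q⟩ => by
      cases h with
      | ite_pos _ h => exact ⟨_, _, h, q⟩
      | ite_neg hn _ => exact absurd hv hn, fun ⟨_, _, h, q⟩ => ⟨_, _, .ite_pos hv h, q⟩⟩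
  · exact ⟨fun ⟨_, _, h, q⟩ => by
      cases h with
      | ite_pos hn _ => exact absurd hn hv
      | ite_neg _ h => exact ⟨_, _, h, q⟩, fun ⟨_, _, h, q⟩ => ⟨_, _, .ite_neg hv h, q⟩⟩

/-- A loop whose invariant `I` is indexed by the number of iterations still to come. -/
theorem wp_while {v : Var} {S : Stmt} (I : ℕ → St → Prop) (b : ℕ)
    (h0 : ∀ σ, I 0 σ → ¬ 0 < σ.s v)
    (hs : ∀ q σ, I (q + 1) σ → 0 < σ.s v ∧ Wp S σ fun σ' t => t ≤ b ∧ I q σ')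
    {q : ℕ} {σ : St} (hI : I q σ) :
    Wp (.while v S) σ fun σ' t => t ≤ q * (b + 1) + 1 ∧ I 0 σ' := by
  induction q generalizing σ with
  | zero => exact ⟨σ, 1, .while_neg (h0 σ hI), by omega, hI⟩
  | succ q ih =>
    obtain ⟨hv, σ₁, t₁, he₁, ht₁, hI₁⟩ := hs q σ hI
    obtain ⟨σ₂, t₂, he₂, ht₂, hI₂⟩ := ih hI₁
    refine ⟨σ₂, _, .while_pos hv he₁ he₂, ?_, hI₂⟩
    rw [Nat.succ_mul]
    omega

end RAM

namespace PosLogic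

/-! ## Tree models -/

/-- The additional axioms of RC (`rc = true`) or RJ (`rc = false`). -/
def Extra (rc : Bool) : Formula → Formula → Prop :=
  match rc with
  | true => Monotonicity
  | false => fun _ _ => False

/-- Provability in RC (`rc = true`) or RJ (`rc = false`). -/
abbrev Prov (rc : Bool) : Formula → Formula → Prop := Derives (Extra rc)

/-- Finite trees with nodes `0, …, n - 1` and root `0`. The edge from its parent to a node `c` has
the label `lab c`. -/
structure Tree : Type where
  n : ℕ
  par : ℕ → ℕ
  lab : ℕ → ℕ∞
  val : ℕ → ℕ → Prop

namespace Tree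

variable (T : Tree) (rc : Bool)

/-- There is a downward path all of whose labels are at least `β`. -/
inductive Down (β : ℕ∞) : ℕ → ℕ → Prop
  | refl (x : ℕ) : Down β x x
  | step {c y : ℕ} : 0 < c → c < T.n → β ≤ T.lab c → Down β c y → Down β (T.par c) y

/-- There is an upward path all of whose labels are greater than `β`. -/
inductive Up (β : ℕ∞) : ℕ → ℕ → Prop
  | refl (x : ℕ) : Up β x x
  | step {x y : ℕ} : 0 < x → x < T.n → β < T.lab x → Up β (T.par x) y → Up β x y

/-- There is a downward path all of whose labels are at least `β`, and one of them is admissible: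
equal to `β` in the case of RJ, arbitrary in the case of RC. -/
def SDown (β : ℕ∞) (x y : ℕ) : Prop :=
  ∃ c, 0 < c ∧ c < T.n ∧ T.Down β x (T.par c) ∧ β ≤ T.lab c ∧ (rc = true ∨ T.lab c = β) ∧
    T.Down β c y

/-- The accessibility relations of the closure of the tree. -/
def Rel (β : ℕ∞) (x y : ℕ) : Prop := ∃ w, T.Up β x w ∧ T.SDown rc β w y

/-- Truth of a formula at a node. -/
def Sat : Formula → ℕ → Prop
  | .var i, x => T.val x i
  | .top, _ => True
  | .and A B, x => Sat A x ∧ Sat B x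
  | .dia β A, x => ∃ y, T.Rel rc β x y ∧ Sat A y

/-! ### Composition of paths and the frame conditions. -/

variable {T rc} {α β : ℕ∞} {x y z w : ℕ}

theorem Down.trans (h : T.Down β x y) (h' : T.Down β y z) : T.Down β x z := by
  induction h with
  | refl => exact h'
  | step h₁ h₂ h₃ _ ih => exact .step h₁ h₂ h₃ (ih h')

theorem Up.trans (h : T.Up β x y) (h' : T.Up β y z) : T.Up β x z := by
  induction h with
  | refl => exact h'
  | step h₁ h₂ h₃ _ ih => exact .step h₁ h₂ h₃ (ih h')

theorem Down.mono (h : T.Down α x y) (hβ : β ≤ α) : T.Down β x y := by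
  induction h with
  | refl => exact .refl _
  | step h₁ h₂ h₃ _ ih => exact .step h₁ h₂ (hβ.trans h₃) ih

theorem Up.mono (h : T.Up α x y) (hβ : β ≤ α) : T.Up β x y := by
  induction h with
  | refl => exact .refl _
  | step h₁ h₂ h₃ _ ih => exact .step h₁ h₂ (hβ.trans_lt h₃) ih

theorem Up.down (h : T.Up β x y) : T.Down β y x := by
  induction h with
  | refl => exact .refl _
  | step h₁ h₂ h₃ _ ih => exact ih.trans (.step h₁ h₂ h₃.le (.refl _))

theorem Down.up (h : T.Down α x y) (hβ : β < α) : T.Up β y x := by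
  induction h with
  | refl => exact .refl _
  | step h₁ h₂ h₃ _ ih => exact ih.trans (.step h₁ h₂ (hβ.trans_le h₃) (.refl _))

theorem Down.last (h : T.Down β x y) : x = y ∨ T.Down β x (T.par y) := by
  induction h with
  | refl => exact .inl rfl
  | step h₁ h₂ h₃ _ ih =>
    rcases ih with rfl | ih
    · exact .inr (.refl _)
    · exact .inr (.step h₁ h₂ h₃ ih)

theorem SDown.down (h : T.SDown rc β x y) : T.Down β x y := by
  obtain ⟨c, h₁, h₂, h₃, h₄, -, h₆⟩ := h
  exact h₃.trans (.step h₁ h₂ h₄ h₆)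

theorem Down.trans_sDown (h : T.Down β x y) (h' : T.SDown rc β y z) : T.SDown rc β x z := by
  obtain ⟨c, h₁, h₂, h₃, h₄⟩ := h'
  exact ⟨c, h₁, h₂, h.trans h₃, h₄⟩

theorem SDown.trans_down (h : T.SDown rc β x y) (h' : T.Down β y z) : T.SDown rc β x z := by
  obtain ⟨c, h₁, h₂, h₃, h₄, h₅, h₆⟩ := h
  exact ⟨c, h₁, h₂, h₃, h₄, h₅, h₆.trans h'⟩

theorem SDown.mono (h : T.SDown true α x y) (hβ : β ≤ α) : T.SDown true β x y := by
  obtain ⟨c, h₁, h₂, h₃, h₄, h₅, h₆⟩ := h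
  exact ⟨c, h₁, h₂, h₃.mono hβ, hβ.trans h₄, .inl rfl, h₆.mono hβ⟩

/-- Parents are unique, so the climb retraces the descent: it stops on it, or passes through `x` and
goes on above. -/
theorem Down.up_cases (h : T.Down β x y) (h' : T.Up β y w) : T.Down β x w ∨ T.Up β x w := by
  induction h' with
  | refl => exact .inl h
  | step h₁ h₂ h₃ h₄ ih =>
    rcases h.last with rfl | h
    · exact .inr (.step h₁ h₂ h₃ h₄)
    · exact ih h

/-- The climb only uses labels greater than `α ≥ β`, so it cannot cross the edge labelled exactly
`β`, and `w` is still below that edge. -/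
theorem SDown.sDown_of_up (h : T.SDown false β x y) (hβ : β ≤ α) (h' : T.Up α y w) :
    T.SDown false β x w := by
  induction h' with
  | refl => exact h
  | step h₁ h₂ h₃ h₄ ih =>
    refine ih ?_
    obtain ⟨c, k₁, k₂, k₃, k₄, k₅, k₆⟩ := h
    rcases k₆.last with rfl | k₆
    · rcases k₅ with k₅ | k₅
      · simp at k₅
      · exact absurd h₃ (not_lt.2 (k₅ ▸ hβ))
    · exact ⟨c, k₁, k₂, k₃, k₄, k₅, k₆⟩

/-- Both ends lie on the one path from `x` towards the root, so one of them is above the other. -/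
theorem Up.up_cases (h : T.Up α x y) (h' : T.Up β x w) : T.Up β y w ∨ T.Down α y w := by
  induction h with
  | refl => exact .inl h'
  | step h₁ h₂ h₃ h₄ ih =>
    cases h' with
    | refl => exact .inr (Up.step h₁ h₂ h₃ h₄).down
    | step _ _ _ k₄ => exact ih k₄

/-- The climb out of `y` first retraces the descent into `y`. If it stops there, the two descents
join; otherwise the two climbs do. -/
theorem Rel.high_low (hβ : β ≤ α) (h : T.Rel rc α x y) (h' : T.Rel rc β y z) :
    T.Rel rc β x z := by
  obtain ⟨w, h₁, h₂⟩ := h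
  obtain ⟨w', h₁', h₂'⟩ := h'
  rcases (h₂.down.mono hβ).up_cases h₁' with h | h
  · exact ⟨w, h₁.mono hβ, h.trans_sDown h₂'⟩
  · exact ⟨w', (h₁.mono hβ).trans h, h₂'⟩

/-- In RJ the climb out of `y` stays below the edge labelled `β`, so the descents join. In RC that
edge may be crossed, but then the last descent serves for `β` as well. -/
theorem Rel.low_high (hβ : β ≤ α) (h : T.Rel rc β x y) (h' : T.Rel rc α y z) :
    T.Rel rc β x z := by
  obtain ⟨w, h₁, h₂⟩ := h
  obtain ⟨w', h₁', h₂'⟩ := h'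
  cases rc with
  | false => exact ⟨w, h₁, (h₂.sDown_of_up hβ h₁').trans_down (h₂'.down.mono hβ)⟩
  | true =>
    rcases h₂.down.up_cases (h₁'.mono hβ) with h | h
    · exact ⟨w, h₁, h.trans_sDown (h₂'.mono hβ)⟩
    · exact ⟨w', h₁.trans h, h₂'.mono hβ⟩

/-- The descent to `y` has labels at least `α > β`, so it can be climbed back for `β`; what remains
is to compare two climbs from `x`. -/
theorem Rel.eucl (hβ : β < α) (h : T.Rel rc α x y) (h' : T.Rel rc β x z) : T.Rel rc β y z := by
  obtain ⟨w, h₁, h₂⟩ := h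
  obtain ⟨w', h₁', h₂'⟩ := h'
  rcases h₁.up_cases h₁' with h | h
  · exact ⟨w', (h₂.down.up hβ).trans h, h₂'⟩
  · exact ⟨w, h₂.down.up hβ, (h.mono hβ.le).trans_sDown h₂'⟩

theorem Rel.mono (hβ : β ≤ α) (h : T.Rel true α x y) : T.Rel true β x y := by
  obtain ⟨w, h₁, h₂⟩ := h
  exact ⟨w, h₁.mono hβ, h₂.mono hβ⟩

/-- The calculi are sound for their tree models. -/
theorem sat_of_prov {A B : Formula} (h : Prov rc A B) : ∀ {x}, T.Sat rc A x → T.Sat rc B x := by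
  induction h with
  | refl => exact id
  | top => exact fun _ => trivial
  | syllogism _ _ ih₁ ih₂ => exact fun h => ih₂ (ih₁ h)
  | and_left => exact And.left
  | and_right => exact And.right
  | and_intro _ _ ih₁ ih₂ => exact fun h => ⟨ih₁ h, ih₂ h⟩
  | dia_mono α _ ih => exact fun ⟨y, h, hy⟩ => ⟨y, h, ih hy⟩
  | dia_dia α A => exact fun ⟨y, h, z, h', hz⟩ => ⟨z, h.high_low le_rfl h', hz⟩
  | dia_high_low A hβ => exact fun ⟨y, h, z, h', hz⟩ => ⟨z, h.high_low hβ h', hz⟩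
  | dia_low_high A hβ => exact fun ⟨y, h, z, h', hz⟩ => ⟨z, h.low_high hβ h', hz⟩
  | dia_and A B hβ => exact fun ⟨⟨y, h, hy⟩, z, h', hz⟩ => ⟨y, h, hy, z, h.eucl hβ h', hz⟩
  | extra h =>
    cases rc with
    | false => exact h.elim
    | true =>
      obtain ⟨A, hβ⟩ := h
      exact fun ⟨y, h, hy⟩ => ⟨y, h.mono hβ.le, hy⟩

/-! ### Theories -/

/-- Sets of formulas closed under provability and conjunction. -/
structure IsTheory (rc : Bool) (t : Formula → Prop) : Prop where
  top : t .top
  and {A B : Formula} : t A → t B → t (.and A B)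
  mono {A B : Formula} : t A → Prov rc A B → t B

/-- A family of theories, one for each node, that is compatible with the tree. -/
structure IsFamily (T : Tree) (rc : Bool) (Th : ℕ → Formula → Prop) : Prop where
  theory (x : ℕ) : IsTheory rc (Th x)
  val {x i : ℕ} : T.val x i → Th x (.var i)
  child {c : ℕ} {B : Formula} : 0 < c → c < T.n → Th c B → Th (T.par c) (.dia (T.lab c) B)
  parent {c : ℕ} {β : ℕ∞} {B : Formula} : 0 < c → c < T.n → β < T.lab c →
    Th (T.par c) (.dia β B) → Th c (.dia β B)

namespace IsFamily

variable {Th : ℕ → Formula → Prop} (hT : IsFamily T rc Th) {B : Formula}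
include hT

theorem of_up (h : T.Up β x w) (hw : Th w (.dia β B)) : Th x (.dia β B) := by
  induction h with
  | refl => exact hw
  | step h₁ h₂ h₃ _ ih => exact hT.parent h₁ h₂ h₃ (ih hw)

/-- The parent contains `γ B` prefixed by the label of `c`, and the axioms (4) collapse two
modalities to the smaller one. That is `β` itself when the label is `β`. -/
theorem dia_child {c : ℕ} {γ : ℕ∞} (h₁ : 0 < c) (h₂ : c < T.n) (hβ : β ≤ T.lab c) (hγ : β ≤ γ)
    (h : Th c (.dia γ B)) : ∃ δ, β ≤ δ ∧ (T.lab c = β → δ = β) ∧ Th (T.par c) (.dia δ B) := by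
  have h' := hT.child h₁ h₂ h
  rcases le_total γ (T.lab c) with hl | hl
  · exact ⟨γ, hγ, fun he => le_antisymm (he ▸ hl) hγ,
      (hT.theory _).mono h' (.dia_high_low B hl)⟩
  · exact ⟨T.lab c, hβ, id, (hT.theory _).mono h' (.dia_low_high B hl)⟩

/-- RJ cannot lower a modality at will, so only the bound `β ≤ γ` survives a descent without a
marked edge. -/
theorem of_down (h : T.Down β x y) (hy : Th y B) : Th x B ∨ ∃ γ, β ≤ γ ∧ Th x (.dia γ B) := by
  induction h with
  | refl => exact .inl hy
  | step h₁ h₂ h₃ _ ih =>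
    rcases ih hy with h | ⟨γ, hγ, h⟩
    · exact .inr ⟨_, h₃, hT.child h₁ h₂ h⟩
    · obtain ⟨δ, hδ, -, h⟩ := hT.dia_child h₁ h₂ h₃ hγ h
      exact .inr ⟨δ, hδ, h⟩

theorem dia_of_down (h : T.Down β x y) (hy : Th y (.dia β B)) : Th x (.dia β B) := by
  induction h with
  | refl => exact hy
  | step h₁ h₂ h₃ _ ih =>
    exact (hT.theory _).mono (hT.child h₁ h₂ (ih hy)) (.dia_high_low B h₃)

theorem of_sDown (h : T.SDown rc β x y) (hy : Th y B) : Th x (.dia β B) := by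
  obtain ⟨c, h₁, h₂, h₃, h₄, h₅, h₆⟩ := h
  refine hT.dia_of_down h₃ ?_
  have : ∃ δ, β ≤ δ ∧ (T.lab c = β → δ = β) ∧ Th (T.par c) (.dia δ B) := by
    rcases hT.of_down h₆ hy with h | ⟨γ, hγ, h⟩
    · exact ⟨_, h₄, id, hT.child h₁ h₂ h⟩
    · exact hT.dia_child h₁ h₂ h₄ hγ h
  obtain ⟨δ, hδ, hδ', h⟩ := this
  -- A modality greater than `β` is lowered by monotonicity in RC; in RJ the edge labelled `β`
  -- excludes it.
  rcases hδ.eq_or_lt with rfl | hlt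
  · exact h
  · rcases h₅ with rfl | h₅
    · exact (hT.theory _).mono h (.extra (Monotonicity.intro B hlt))
    · exact absurd (hδ' h₅) hlt.ne'

/-- One direction is enough because the formulas are positive: no implication or negation requires
the converse in the induction. -/
theorem of_sat : ∀ (B : Formula) {x : ℕ}, T.Sat rc B x → Th x B
  | .var _, _, h => hT.val h
  | .top, _, _ => (hT.theory _).top
  | .and A B, _, h => (hT.theory _).and (of_sat A h.1) (of_sat B h.2)
  | .dia _ B, _, ⟨_, ⟨_, h₁, h₂⟩, hy⟩ => hT.of_up h₁ (hT.of_sDown h₂ (of_sat B hy))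

end IsFamily

/-! ### Local equations for the truth of modal formulas -/

/-- The parents of nodes come before the nodes. -/
def WF (T : Tree) : Prop := ∀ c, 0 < c → c < T.n → T.par c < c

theorem down_iff : T.Down β x y ↔
    x = y ∨ ∃ c, 0 < c ∧ c < T.n ∧ T.par c = x ∧ β ≤ T.lab c ∧ T.Down β c y := by
  constructor
  · rintro (_ | ⟨h₁, h₂, h₃, h₄⟩)
    · exact .inl rfl
    · exact .inr ⟨_, h₁, h₂, rfl, h₃, h₄⟩
  · rintro (rfl | ⟨c, h₁, h₂, rfl, h₃, h₄⟩)
    exacts [.refl _, .step h₁ h₂ h₃ h₄]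

/-- Split at the first edge: the admissible edge lies further below, or the first edge is itself
admissible and a plain descent follows. -/
theorem sDown_iff : T.SDown rc β x y ↔
    ∃ c, 0 < c ∧ c < T.n ∧ T.par c = x ∧ β ≤ T.lab c ∧
      (T.SDown rc β c y ∨ (rc = true ∨ T.lab c = β) ∧ T.Down β c y) := by
  constructor
  · rintro ⟨c, h₁, h₂, h₃, h₄, h₅, h₆⟩
    rcases down_iff.1 h₃ with rfl | ⟨d, k₁, k₂, k₃, k₄, k₅⟩
    · exact ⟨c, h₁, h₂, rfl, h₄, .inr ⟨h₅, h₆⟩⟩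
    · exact ⟨d, k₁, k₂, k₃, k₄, .inl ⟨c, h₁, h₂, k₅, h₄, h₅, h₆⟩⟩
  · rintro ⟨c, h₁, h₂, rfl, h₄, h | ⟨h₅, h₆⟩⟩
    · exact (Down.step h₁ h₂ h₄ (.refl _)).trans_sDown h
    · exact ⟨c, h₁, h₂, .refl _, h₄, h₅, h₆⟩

theorem up_iff : T.Up β x y ↔ x = y ∨ (0 < x ∧ x < T.n ∧ β < T.lab x ∧ T.Up β (T.par x) y) := by
  constructor
  · rintro (_ | ⟨h₁, h₂, h₃, h₄⟩)
    · exact .inl rfl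
    · exact .inr ⟨h₁, h₂, h₃, h₄⟩
  · rintro (rfl | ⟨h₁, h₂, h₃, h₄⟩)
    exacts [.refl _, .step h₁ h₂ h₃ h₄]

/-- The solution of the local equations. -/
theorem WF.rel_of_equations (hT : T.WF) {S G E F : ℕ → Prop}
    (hG : ∀ x < T.n, G x ↔ S x ∨
      ∃ c, 0 < c ∧ c < T.n ∧ T.par c = x ∧ β ≤ T.lab c ∧ G c)
    (hE : ∀ x < T.n, E x ↔ ∃ c, 0 < c ∧ c < T.n ∧ T.par c = x ∧ β ≤ T.lab c ∧
      (E c ∨ (rc = true ∨ T.lab c = β) ∧ G c))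
    (hF : ∀ x < T.n, F x ↔ E x ∨ (0 < x ∧ β < T.lab x ∧ F (T.par x))) :
    ∀ x < T.n, F x ↔ ∃ y, T.Rel rc β x y ∧ S y := by
  -- Children have larger numbers, so induction on `T.n - x` settles the children of a node before
  -- the node. The same induction serves for `E`.
  have hG' : ∀ k, ∀ x < T.n, T.n - x = k → (G x ↔ ∃ y, T.Down β x y ∧ S y) := by
    intro k
    induction k using Nat.strong_induction_on with
    | _ k ih =>
      intro x hx hk
      have key : ∀ c, 0 < c → c < T.n → T.par c = x → (G c ↔ ∃ y, T.Down β c y ∧ S y) :=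
        fun c h₁ h₂ h₃ => ih (T.n - c) (by have := hT c h₁ h₂; omega) c h₂ rfl
      rw [hG x hx]
      constructor
      · rintro (h | ⟨c, h₁, h₂, h₃, h₄, h₅⟩)
        · exact ⟨x, .refl _, h⟩
        · obtain ⟨y, hy, hs⟩ := (key c h₁ h₂ h₃).1 h₅
          exact ⟨y, down_iff.2 (.inr ⟨c, h₁, h₂, h₃, h₄, hy⟩), hs⟩
      · rintro ⟨y, hy, hs⟩
        rcases down_iff.1 hy with rfl | ⟨c, h₁, h₂, h₃, h₄, h₅⟩
        · exact .inl hs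
        · exact .inr ⟨c, h₁, h₂, h₃, h₄, (key c h₁ h₂ h₃).2 ⟨y, h₅, hs⟩⟩
  have hE' : ∀ k, ∀ x < T.n, T.n - x = k → (E x ↔ ∃ y, T.SDown rc β x y ∧ S y) := by
    intro k
    induction k using Nat.strong_induction_on with
    | _ k ih =>
      intro x hx hk
      have key : ∀ c, 0 < c → c < T.n → T.par c = x → (E c ↔ ∃ y, T.SDown rc β c y ∧ S y) :=
        fun c h₁ h₂ h₃ => ih (T.n - c) (by have := hT c h₁ h₂; omega) c h₂ rfl
      rw [hE x hx]
      constructor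
      · rintro ⟨c, h₁, h₂, h₃, h₄, h | ⟨h₅, h₆⟩⟩
        · obtain ⟨y, hy, hs⟩ := (key c h₁ h₂ h₃).1 h
          exact ⟨y, sDown_iff.2 ⟨c, h₁, h₂, h₃, h₄, .inl hy⟩, hs⟩
        · obtain ⟨y, hy, hs⟩ := (hG' _ c h₂ rfl).1 h₆
          exact ⟨y, sDown_iff.2 ⟨c, h₁, h₂, h₃, h₄, .inr ⟨h₅, hy⟩⟩, hs⟩
      · rintro ⟨y, hy, hs⟩
        obtain ⟨c, h₁, h₂, h₃, h₄, h | ⟨h₅, h₆⟩⟩ := sDown_iff.1 hy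
        · exact ⟨c, h₁, h₂, h₃, h₄, .inl ((key c h₁ h₂ h₃).2 ⟨y, h, hs⟩)⟩
        · exact ⟨c, h₁, h₂, h₃, h₄, .inr ⟨h₅, (hG' _ c h₂ rfl).2 ⟨y, h₆, hs⟩⟩⟩
  -- The equation for `F` refers to the parent, so this induction runs from the root downwards.
  intro x
  induction x using Nat.strong_induction_on with
  | _ x ih =>
    intro hx
    rw [hF x hx, hE' _ x hx rfl]
    constructor
    · rintro (⟨y, hy, hs⟩ | ⟨h₁, h₂, h₃⟩)
      · exact ⟨y, ⟨x, .refl _, hy⟩, hs⟩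
      · have hp := hT x h₁ hx
        obtain ⟨y, ⟨w, hw, hy⟩, hs⟩ := (ih _ hp (hp.trans hx)).1 h₃
        exact ⟨y, ⟨w, .step h₁ hx h₂ hw, hy⟩, hs⟩
    · rintro ⟨y, ⟨w, hw, hy⟩, hs⟩
      rcases up_iff.1 hw with rfl | ⟨h₁, h₂, h₃, h₄⟩
      · exact .inl ⟨y, hy, hs⟩
      · have hp := hT x h₁ hx
        exact .inr ⟨h₁, h₃, (ih _ hp (hp.trans hx)).2 ⟨y, ⟨w, h₄, hy⟩, hs⟩⟩

end Tree

end PosLogic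

namespace PosLogic

/-! ## Reading the tree of a formula off its string of symbols -/

/-- States of the reader: the current node, the stack of the nodes to return to, the tree read so
far, and the pairs of a node and a variable true at it. -/
structure Reader : Type where
  cur : ℕ
  stk : List ℕ
  n : ℕ
  par : ℕ → ℕ
  lab : ℕ → ℕ∞
  facts : List (ℕ × ℕ)

namespace Reader

/-- The tree read so far. -/
def tree (M : Reader) : Tree := ⟨M.n, M.par, M.lab, fun x i => (x, i) ∈ M.facts⟩

/-- Reading one symbol. -/
def step (M : Reader) : Symb → Reader
  | .var i => { M with facts := M.facts ++ [(M.cur, i)] }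
  | .top => M
  | .and => { M with cur := M.stk.headD 0 }
  | .lpar => { M with stk := M.cur :: M.stk }
  | .rpar => { M with stk := M.stk.tail }
  | .turnstile => M
  | .dia α =>
      { M with
        cur := M.n
        n := M.n + 1
        par := Function.update M.par M.n M.cur
        lab := Function.update M.lab M.n α }

/-- The initial state of the reader, with the root as the only node. -/
def init : Reader := ⟨0, [], 1, fun _ => 0, fun _ => 0, []⟩

/-- Sanity of a state of the reader. -/
structure Good (M : Reader) : Prop where
  cur_lt : M.cur < M.n
  wf : M.tree.WF
  stk_lt : ∀ x ∈ M.stk, x < M.n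
  facts_lt : ∀ p ∈ M.facts, p.1 < M.n

/-- `M'` arises from `M` by reading more symbols. -/
structure Ext (M M' : Reader) : Prop where
  n_le : M.n ≤ M'.n
  par_eq : ∀ c < M.n, M'.par c = M.par c
  lab_eq : ∀ c < M.n, M'.lab c = M.lab c
  facts_subset : M.facts ⊆ M'.facts

/-! ### Invariants of the reader. -/

variable {M M' M'' : Reader} {rc : Bool} {x y : ℕ} {β : ℕ∞}

theorem good_init : Good init :=
  ⟨by simp [init], fun c h₁ h₂ => by simp [init, tree] at h₂; omega, by simp [init],
    by simp [init]⟩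

theorem Good.step (h : M.Good) (s : Symb) : (M.step s).Good := by
  obtain ⟨h₁, h₂, h₃, h₄⟩ := h
  cases s with
  | var i =>
    refine ⟨h₁, h₂, h₃, fun p hp => ?_⟩
    rcases List.mem_append.1 hp with hp | hp
    · exact h₄ p hp
    · rw [List.mem_singleton.1 hp]; exact h₁
  | top => exact ⟨h₁, h₂, h₃, h₄⟩
  | turnstile => exact ⟨h₁, h₂, h₃, h₄⟩
  | and =>
    refine ⟨?_, h₂, h₃, h₄⟩
    simp only [Reader.step]
    cases hs : M.stk with
    | nil => exact Nat.zero_lt_of_lt h₁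
    | cons a l => exact h₃ a (by simp [hs])
  | lpar =>
    refine ⟨h₁, h₂, fun y hy => ?_, h₄⟩
    rcases List.mem_cons.1 hy with rfl | hy
    exacts [h₁, h₃ y hy]
  | rpar => exact ⟨h₁, h₂, fun y hy => h₃ y (List.mem_of_mem_tail hy), h₄⟩
  | dia α =>
    refine ⟨Nat.lt_succ_self _, fun c hc hn => ?_, fun y hy => (h₃ y hy).trans (Nat.lt_succ_self _),
      fun p hp => (h₄ p hp).trans (Nat.lt_succ_self _)⟩
    rcases (Nat.lt_succ_iff_lt_or_eq.1 hn) with hn | rfl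
    · have := h₂ c hc hn
      simpa [tree, Reader.step, Function.update_of_ne hn.ne] using this
    · simpa [tree, Reader.step] using h₁

theorem Good.foldl (h : M.Good) (l : List Symb) : (l.foldl Reader.step M).Good := by
  induction l generalizing M with
  | nil => exact h
  | cons s l ih => exact ih (h.step s)

theorem Ext.refl (M : Reader) : M.Ext M :=
  ⟨le_rfl, fun _ _ => rfl, fun _ _ => rfl, List.Subset.refl _⟩

theorem Ext.trans (h : M.Ext M') (h' : M'.Ext M'') : M.Ext M'' :=
  ⟨h.n_le.trans h'.n_le,
    fun c hc => (h'.par_eq c (hc.trans_le h.n_le)).trans (h.par_eq c hc),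
    fun c hc => (h'.lab_eq c (hc.trans_le h.n_le)).trans (h.lab_eq c hc),
    fun _ hp => h'.facts_subset (h.facts_subset hp)⟩

theorem ext_step (M : Reader) (s : Symb) : M.Ext (M.step s) := by
  cases s with
  | var i => exact ⟨le_rfl, fun _ _ => rfl, fun _ _ => rfl, List.subset_append_left _ _⟩
  | dia α =>
    exact ⟨Nat.le_succ _, fun c hc => Function.update_of_ne hc.ne _ _,
      fun c hc => Function.update_of_ne hc.ne _ _, List.Subset.refl _⟩
  | _ => exact ⟨le_rfl, fun _ _ => rfl, fun _ _ => rfl, List.Subset.refl _⟩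

theorem ext_foldl (M : Reader) (l : List Symb) : M.Ext (l.foldl Reader.step M) := by
  induction l generalizing M with
  | nil => exact .refl M
  | cons s l ih => exact (M.ext_step s).trans (ih _)

/-- A symbol adds a node or a fact, never both; hence the tree and its facts together have size
linear in the formula. -/
theorem size_step (M : Reader) (s : Symb) :
    (M.step s).n + (M.step s).facts.length ≤ M.n + M.facts.length + 1 := by
  cases s <;> simp [step] <;> omega

theorem size_foldl (M : Reader) (l : List Symb) :
    (l.foldl Reader.step M).n + (l.foldl Reader.step M).facts.length ≤
      M.n + M.facts.length + l.length := by
  induction l generalizing M with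
  | nil => simp
  | cons s l ih =>
    have h₁ := ih (M.step s)
    have h₂ := M.size_step s
    simp only [List.foldl_cons, List.length_cons]
    omega

/-- Brackets are balanced, so the node saved at an opening bracket is again on top when the matching
`∧` is read. -/
theorem stk_foldl (A : Formula) : ∀ M : Reader, (A.symbols.foldl step M).stk = M.stk := by
  induction A with
  | var i => exact fun _ => rfl
  | top => exact fun _ => rfl
  | and A B ihA ihB =>
    intro M
    simp [Formula.symbols, ihB, ihA, step]
  | dia α A ih =>
    intro M
    simp [Formula.symbols, ih, step]

theorem foldl_and (A B : Formula) (M : Reader) :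
    ∃ M₁ M₂ M₃ M₄ : Reader, M₁ = M.step .lpar ∧ M₂ = A.symbols.foldl step M₁ ∧
      M₃ = M₂.step .and ∧ M₃.cur = M.cur ∧ M₄ = B.symbols.foldl step M₃ ∧
      (Formula.and A B).symbols.foldl step M = M₄.step .rpar := by
  refine ⟨_, _, _, _, rfl, rfl, rfl, ?_, rfl, ?_⟩
  · simp [step, stk_foldl]
  · simp [Formula.symbols]

/-! ### The formula is true at the node at which it is read -/

theorem Ext.down (h : M.Ext M') (hx : M.tree.Down β x y) :
    M'.tree.Down β x y := by
  induction hx with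
  | refl => exact .refl _
  | step h₁ h₂ h₃ _ ih =>
    rename_i c y _
    have := Tree.Down.step (T := M'.tree) (β := β) h₁ (h₂.trans_le h.n_le)
      (by rw [show M'.tree.lab c = _ from h.lab_eq c h₂]; exact h₃) ih
    rwa [show M'.tree.par c = _ from h.par_eq c h₂] at this

theorem Ext.up (h : M.Ext M') (hx : M.tree.Up β x y) : M'.tree.Up β x y := by
  induction hx with
  | refl => exact .refl _
  | step h₁ h₂ h₃ _ ih =>
    rename_i x y _
    refine Tree.Up.step (T := M'.tree) (β := β) h₁ (h₂.trans_le h.n_le)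
      (by rw [show M'.tree.lab x = _ from h.lab_eq x h₂]; exact h₃) ?_
    rwa [show M'.tree.par x = _ from h.par_eq x h₂]

theorem Ext.rel (h : M.Ext M') (hx : M.tree.Rel rc β x y) : M'.tree.Rel rc β x y := by
  obtain ⟨w, h₁, c, k₁, k₂, k₃, k₄, k₅, k₆⟩ := hx
  refine ⟨w, h.up h₁, c, k₁, k₂.trans_le h.n_le, ?_, ?_, ?_, h.down k₆⟩
  · rw [show M'.tree.par c = _ from h.par_eq c k₂]; exact h.down k₃
  · rw [show M'.tree.lab c = _ from h.lab_eq c k₂]; exact k₄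
  · rw [show M'.tree.lab c = _ from h.lab_eq c k₂]; exact k₅

/-- Positive formulas persist when nodes, edges and facts are only added. -/
theorem Ext.sat (h : M.Ext M') : ∀ (A : Formula) {x : ℕ}, M.tree.Sat rc A x → M'.tree.Sat rc A x
  | .var _, _, hx => h.facts_subset hx
  | .top, _, _ => trivial
  | .and A B, _, hx => ⟨h.sat A hx.1, h.sat B hx.2⟩
  | .dia _ A, _, ⟨y, hy, hs⟩ => ⟨y, h.rel hy, h.sat A hs⟩

/-- A modality is witnessed by the child that it creates, and the truth of a first conjunct survives
the reading of the second by `Ext.sat`. -/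
theorem sat_foldl (A : Formula) : ∀ M : Reader, M.Good →
    (A.symbols.foldl step M).tree.Sat rc A M.cur := by
  induction A with
  | var i => exact fun M _ => by simp [Formula.symbols, Tree.Sat, tree, step]
  | top => exact fun _ _ => trivial
  | and A B ihA ihB =>
    intro M hM
    obtain ⟨M₁, M₂, M₃, M₄, h₁, h₂, h₃, hc, h₄, h₅⟩ := foldl_and A B M
    have g₁ : M₁.Good := h₁ ▸ hM.step _
    have g₂ : M₂.Good := h₂ ▸ g₁.foldl _
    have g₃ : M₃.Good := h₃ ▸ g₂.step _
    have e₁ : M₂.Ext (M₄.step .rpar) := by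
      have := M₂.ext_step .and
      rw [← h₃] at this
      exact this.trans (h₄ ▸ (M₃.ext_foldl _).trans (ext_step _ _))
    rw [h₅]
    refine ⟨e₁.sat A ?_, (M₄.ext_step .rpar).sat B ?_⟩
    · have := ihA M₁ g₁
      rw [← h₂] at this
      rwa [h₁] at this
    · have := ihB M₃ g₃
      rwa [← h₄, hc] at this
  | dia α A ih =>
    intro M hM
    have g := hM.step (.dia α)
    have e := (M.step (.dia α)).ext_foldl A.symbols
    refine ⟨M.n, e.rel ?_, ih _ g⟩
    refine ⟨M.cur, .refl _, M.n, ?_, Nat.lt_succ_self _, ?_, ?_, ?_, .refl _⟩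
    · exact Nat.zero_lt_of_lt hM.cur_lt
    · simpa [step, tree] using Tree.Down.refl _
    · simp [step, tree]
    · simp [step, tree]

/-! ### The theories of the nodes -/

/-- Conjunctions of formulas `β C` with `β < α`. -/
inductive Low (α : ℕ∞) : Formula → Prop
  | top : Low α .top
  | dia {β : ℕ∞} (C : Formula) : β < α → Low α (.dia β C)
  | and {D D' : Formula} : Low α D → Low α D' → Low α (.and D D')

/-- Axiom (5) absorbs the conjuncts of `D` into the scope of `α` one after another; generalizing `A`
lets it collect those already absorbed. -/
theorem Low.prov {α : ℕ∞} {D : Formula} (h : Low α D) (A : Formula) :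
    Prov rc (.and (.dia α A) D) (.dia α (.and A D)) := by
  induction h generalizing A with
  | top =>
    exact .syllogism (.and_left _ _) (.dia_mono _ (.and_intro (.refl _) (.top _)))
  | dia C hβ => exact .dia_and _ _ hβ
  | @and D D' _ _ ih ih' =>
    have h₁ : Prov rc (.and (.dia α A) (.and D D')) (.and (.dia α (.and A D)) D') :=
      .and_intro (.syllogism (.and_intro (.and_left _ _)
        (.syllogism (.and_right _ _) (.and_left _ _))) (ih A))
        (.syllogism (.and_right _ _) (.and_right _ _))
    refine .syllogism h₁ (.syllogism (ih' _) (.dia_mono _ ?_))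
    exact .and_intro (.syllogism (.and_left _ _) (.and_left _ _))
      (.and_intro (.syllogism (.and_left _ _) (.and_right _ _)) (.and_right _ _))

/-- The theory of a new child with label `α` at which `A` holds, of a node with theory `t`. -/
def childTheory (rc : Bool) (t : Formula → Prop) (α : ℕ∞) (A : Formula) (B : Formula) : Prop :=
  ∃ D, Low α D ∧ t D ∧ Prov rc (.and A D) B

theorem isTheory_childTheory {t : Formula → Prop} (ht : Tree.IsTheory rc t) (α : ℕ∞)
    (A : Formula) : Tree.IsTheory rc (childTheory rc t α A) where
  top := ⟨.top, .top, ht.top, .top _⟩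
  and := by
    rintro B B' ⟨D, h₁, h₂, h₃⟩ ⟨D', h₁', h₂', h₃'⟩
    refine ⟨.and D D', h₁.and h₁', ht.and h₂ h₂', .and_intro ?_ ?_⟩
    · exact .syllogism (.and_intro (.and_left _ _) (.syllogism (.and_right _ _) (.and_left _ _))) h₃
    · exact .syllogism (.and_intro (.and_left _ _) (.syllogism (.and_right _ _) (.and_right _ _)))
        h₃'
  mono := by
    rintro B B' ⟨D, h₁, h₂, h₃⟩ h
    exact ⟨D, h₁, h₂, h₃.syllogism h⟩

/-- The invariant is that the theory of the current node contains the formula about to be read.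
Theories of old nodes never change, so after the first conjunct has been read the second is still in
the theory of the node returned to. -/
theorem exists_isFamily_foldl (A : Formula) : ∀ (M : Reader) (Th : ℕ → Formula → Prop), M.Good →
    M.tree.IsFamily rc Th → Th M.cur A →
    ∃ Th', (∀ x < M.n, Th' x = Th x) ∧ (A.symbols.foldl step M).tree.IsFamily rc Th' := by
  induction A with
  | var i =>
    refine fun M Th hM hT hA => ⟨Th, fun _ _ => rfl, ⟨hT.theory, ?_, hT.child, hT.parent⟩⟩
    intro x j hx
    rcases List.mem_append.1 hx with hx | hx
    · exact hT.val hx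
    · obtain ⟨rfl, rfl⟩ := Prod.mk.inj (List.mem_singleton.1 hx)
      exact hA
  | top => exact fun M Th _ hT _ => ⟨Th, fun _ _ => rfl, hT⟩
  | and A B ihA ihB =>
    intro M Th hM hT hAB
    obtain ⟨M₁, M₂, M₃, M₄, h₁, h₂, h₃, hc, h₄, h₅⟩ := foldl_and A B M
    have g₁ : M₁.Good := h₁ ▸ hM.step _
    have g₂ : M₂.Good := h₂ ▸ g₁.foldl _
    have g₃ : M₃.Good := h₃ ▸ g₂.step _
    obtain ⟨Th₁, e₁, hT₁⟩ := ihA M₁ Th g₁ (by subst h₁; exact hT)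
      (by subst h₁; exact (hT.theory _).mono hAB (.and_left _ _))
    rw [← h₂] at hT₁
    have n₁ : M₁.n = M.n := by rw [h₁]; rfl
    have n₃ : M.n ≤ M₃.n := by
      rw [← n₁]; subst h₃; rw [h₂]; exact (ext_foldl M₁ _).n_le
    obtain ⟨Th₂, e₂, hT₂⟩ := ihB M₃ Th₁ g₃ (by subst h₃; exact hT₁) (by
      rw [hc, e₁ _ (n₁ ▸ hM.cur_lt)]
      exact (hT.theory _).mono hAB (.and_right _ _))
    rw [← h₄] at hT₂
    rw [h₅]
    exact ⟨Th₂, fun x hx => (e₂ x (hx.trans_le n₃)).trans (e₁ x (n₁ ▸ hx)), hT₂⟩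
  | dia α A ih =>
    intro M Th hM hT hA
    have hc : ∀ x < M.n, Function.update Th M.n (childTheory rc (Th M.cur) α A) x = Th x :=
      fun x hx => Function.update_of_ne hx.ne _ _
    have hF : (M.step (.dia α)).tree.IsFamily rc
        (Function.update Th M.n (childTheory rc (Th M.cur) α A)) := by
      refine ⟨fun x => ?_, fun {x i} hx => ?_, fun {c B} h₁ h₂ hB => ?_,
        fun {c β B} h₁ h₂ hβ hB => ?_⟩
      · rcases eq_or_ne x M.n with rfl | hx
        · rw [Function.update_self]
          exact isTheory_childTheory (hT.theory _) _ _
        · rw [Function.update_of_ne hx]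
          exact hT.theory x
      · rw [hc x (hM.facts_lt (x, i) hx)]
        exact hT.val hx
      · rcases Nat.lt_succ_iff_lt_or_eq.1 h₂ with h₂ | rfl
        · have hp : M.par c < c := hM.wf c h₁ h₂
          simp only [tree, step, Function.update_of_ne h₂.ne,
            Function.update_of_ne (hp.trans h₂).ne] at hB ⊢
          exact hT.child h₁ h₂ hB
        · simp only [tree, step, Function.update_self,
            Function.update_of_ne hM.cur_lt.ne] at hB ⊢
          -- The parent contains `α A` and `D`, hence `α (A ∧ D)` by `Low.prov`, hence `α B`.
          obtain ⟨D, hD, htD, hp⟩ := hB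
          exact (hT.theory _).mono ((hT.theory _).mono ((hT.theory _).and hA htD) (hD.prov A))
            (.dia_mono _ hp)
      · rcases Nat.lt_succ_iff_lt_or_eq.1 h₂ with h₂ | rfl
        · have hp : M.par c < c := hM.wf c h₁ h₂
          simp only [tree, step, Function.update_of_ne h₂.ne,
            Function.update_of_ne (hp.trans h₂).ne] at hB hβ ⊢
          exact hT.parent h₁ h₂ hβ hB
        · simp only [tree, step, Function.update_self,
            Function.update_of_ne hM.cur_lt.ne] at hB hβ ⊢
          -- The formula `β B` of the parent itself serves as `D`.
          exact ⟨_, .dia B hβ, hB, .and_right _ _⟩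
    obtain ⟨Th', e, hT'⟩ := ih (M.step (.dia α))
      (Function.update Th M.n (childTheory rc (Th M.cur) α A)) (hM.step _) hF (by
        simp only [step, Function.update_self]
        exact ⟨.top, .top, (hT.theory _).top, .and_left _ _⟩)
    exact ⟨Th', fun x hx => (e x (hx.trans (Nat.lt_succ_self _))).trans (hc x hx), hT'⟩

/-- The tree of a formula. -/
def ofFormula (A : Formula) : Reader := A.symbols.foldl step init

theorem good_ofFormula (A : Formula) : (ofFormula A).Good := good_init.foldl _

/-- Provability is truth at the root of the tree. -/
theorem prov_iff_sat (A B : Formula) : Prov rc A B ↔ (ofFormula A).tree.Sat rc B 0 := by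
  refine ⟨fun h => Tree.sat_of_prov h (sat_foldl A init good_init), fun h => ?_⟩
  -- Initially only the root exists, so the conditions on edges are vacuous and the constant family
  -- is allowed.
  obtain ⟨Th, e, hT⟩ := exists_isFamily_foldl (rc := rc) A init (fun _ => Prov rc A) good_init
    ⟨fun _ => ⟨.top _, .and_intro, .syllogism⟩, fun h => by simp [tree, init] at h,
      fun h₁ h₂ => by simp [tree, init] at h₂; omega,
      fun h₁ h₂ => by simp [tree, init] at h₂; omega⟩ (.refl A)
  have := hT.of_sat B h
  rwa [e 0 (by simp [init])] at this

end Reader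

/-! ## Reading a formula from right to left as a program for a stack machine -/

/-- The effect of a symbol on a stack of formulas. -/
def stackStep (s : Symb) (l : List Formula) : List Formula :=
  match s, l with
  | .var i, l => .var i :: l
  | .top, l => .top :: l
  | .lpar, A :: B :: l => .and A B :: l
  | .dia α, A :: l => .dia α A :: l
  | _, l => l

/-- From right to left both operands precede the opening bracket, which acts as the binary
connective; `∧` and the closing bracket do nothing. -/
theorem foldr_stackStep (B : Formula) (l : List Formula) :
    B.symbols.foldr stackStep l = B :: l := by
  induction B generalizing l with
  | var i => rfl
  | top => rfl
  | and A B ihA ihB => simp [Formula.symbols, stackStep, ihA, ihB]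
  | dia α A ih => simp [Formula.symbols, stackStep, ih]

end PosLogic

namespace RAM

open PosLogic

/-! ## The decision procedure -/

/-- Sequential composition of a list of programs. -/
def block (l : List Stmt) : Stmt := l.foldr .seq .skip

@[simp] theorem wp_block_nil {σ : St} {Q : St → ℕ → Prop} : Wp (block []) σ Q ↔ Q σ 0 := wp_skip

@[simp] theorem wp_block_cons {σ : St} {Q : St → ℕ → Prop} {S : Stmt} {l : List Stmt} :
    Wp (block (S :: l)) σ Q ↔ Wp S σ fun σ₁ t₁ => Wp (block l) σ₁ fun σ₂ t₂ => Q σ₂ (t₁ + t₂) :=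
  wp_seq

/-- The comparison of the modalities with the codes `x` and `y`: `r` becomes 1 if the first is
greater than or equal to the second, and 0 otherwise. -/
def geTest (x y : Var) : Stmt := block
  [.sub .d .seven x, .ite .d (.const .r 1) (block
    [.sub .d .seven y, .ite .d (.const .r 0) (block
      [.sub .d x y, .add .d .d .one, .ite .d (.const .r 1) (.const .r 0)])])]

/-- A case distinction on the symbol with the code `c`. -/
def dispatch (h : Symb → Stmt) : Stmt := block
  [.sub .d .zero .c, .ite .d (h (.var 0)) (block
    [.sub .d .c .five, .ite .d (h (.dia 0)) (block
      [.sub .d .c .one, .ite .d (block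
        [.sub .d .d .one, .ite .d (block
          [.sub .d .d .one, .ite .d (block
            [.sub .d .d .one, .ite .d (h .turnstile) (h .rpar)]) (h .lpar)]) (h .and)])
        (h .top)])])]

/-- The program for one symbol of the left-hand side. -/
def readStep : Symb → Stmt
  | .var _ => block [.put .fv .f .c, .put .fn .f .cur, .add .f .f .one]
  | .top => .skip
  | .and => .ite .sp (block [.sub .j .sp .one, .get .cur .stk .j]) (.const .cur 0)
  | .lpar => block [.put .stk .sp .cur, .add .sp .sp .one]
  | .rpar => .ite .sp (.sub .sp .sp .one) .skip
  | .turnstile => .const .go 0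
  | .dia _ => block [.put .par .n .cur, .put .lab .n .c, .add .cur .n .zero, .add .n .n .one]

/-- The program that reads the left-hand side. -/
def readLeft : Stmt := .while .go (block [.read .c, dispatch readStep])

/-- The program that reads the right-hand side. -/
def readRight : Stmt := .while .go (block [.read .c,
  .ite .c (block [.put .inb .m .c, .add .m .m .one])
    (block [.sub .d .zero .c,
      .ite .d (block [.put .inb .m .c, .add .m .m .one]) (.const .go 0)])])

/-- Fill the next vector with the value of `w`. -/
def fill (w : Var) : Stmt := block
  [.add .i .n .zero, .while .i (block [.sub .i .i .one, .add .j .top .i, .put .vec .j w])]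

/-- Mark the nodes at which the variable with the code `c` is true. -/
def mark : Stmt := block
  [.add .i .f .zero, .while .i (block [.sub .i .i .one, .get .l .fv .i, .sub .d .l .c,
    .ite .d .skip (block [.sub .d .c .l, .ite .d .skip (block
      [.get .p .fn .i, .add .j .top .p, .put .vec .j .one])])])]

/-- Replace the last two vectors by their meet. -/
def meet : Stmt := block
  [.sub .top .top .n, .add .i .n .zero, .while .i (block [.sub .i .i .one, .add .j .top .i,
    .get .g .vec .j, .ite .g .skip (block [.sub .k .j .n, .put .vec .k .zero])])]

/-- Clear the auxiliary vector. -/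
def clear : Stmt := block
  [.add .i .n .zero, .while .i (block [.sub .i .i .one, .put .er .i .zero])]

/-- The test whether the label `l`, not less than `c`, is admissible. -/
def admissible (rc : Bool) : Stmt :=
  match rc with
  | true => .const .r 1
  | false => geTest .c .l

/-- Propagation from the node `i` to its parent `p`, along an edge with a label not less than `c`. -/
def propagate (rc : Bool) : Stmt := block
  [.add .j .base .i, .get .g .vec .j,
    .ite .g (block [.add .j .base .p, .put .vec .j .one, admissible rc,
      .ite .r (.put .er .p .one) .skip]) .skip]

/-- The step of `downPass` for the node `i`. -/
def downStep (rc : Bool) : Stmt := block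
  [.get .l .lab .i, geTest .l .c,
    .ite .r (block [.get .p .par .i, propagate rc,
      .get .g .er .i, .ite .g (.put .er .p .one) .skip]) .skip,
    .sub .i .i .one]

/-- The pass through the tree from the leaves to the root. -/
def downPass (rc : Bool) : Stmt := block [.sub .i .n .one, .while .i (downStep rc)]

/-- The step of `upPass` for the node `i`. -/
def upStep : Stmt := block
  [.ite .i (block [.get .l .lab .i, geTest .c .l, .ite .r .skip (block
    [.get .p .par .i, .get .g .er .p, .ite .g (.put .er .i .one) .skip])]) .skip,
    .get .g .er .i, .add .j .base .i, .put .vec .j .g, .add .i .i .one, .sub .k .k .one]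

/-- The pass through the tree from the root to the leaves. -/
def upPass : Stmt := block [.add .k .n .zero, .const .i 0, .while .k upStep]

/-- The program for one symbol of the right-hand side. -/
def evalStep (rc : Bool) : Symb → Stmt
  | .var _ => block [fill .zero, mark, .add .top .top .n]
  | .top => block [fill .one, .add .top .top .n]
  | .lpar => meet
  | .dia _ => block [.sub .base .top .n, clear, downPass rc, upPass]
  | _ => .skip

/-- The program that evaluates the right-hand side. -/
def evalRight (rc : Bool) : Stmt :=
  .while .m (block [.sub .m .m .one, .get .c .inb .m, dispatch (evalStep rc)])

/-- The decision procedure. -/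
def decider (rc : Bool) : Stmt := block
  [.const .one 1, .const .five 5, .const .seven 7, .const .n 1, .const .go 1, readLeft,
    .const .go 1, readRight, evalRight rc, .get .g .vec .zero,
    .ite .g (.print .one) (.print .zero)]

/-! ### Frames -/

/-- Scalars that are used as temporary storage in the evaluation. -/
def Var.temp : Var → Bool
  | .d | .i | .j | .k | .l | .r | .p | .g | .top | .base => true
  | _ => false

/-- Arrays that are changed in the evaluation. -/
def Arr.temp : Arr → Bool
  | .vec | .er => true
  | _ => false

/-- The states agree but for temporary storage. -/
structure Same (σ σ' : St) : Prop where
  s : ∀ v, v.temp = false → σ'.s v = σ.s v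
  a : ∀ k, k.temp = false → σ'.a k = σ.a k
  inp : σ'.inp = σ.inp
  out : σ'.out = σ.out

theorem Same.refl (σ : St) : Same σ σ := ⟨fun _ _ => rfl, fun _ _ => rfl, rfl, rfl⟩

theorem Same.trans {σ₁ σ₂ σ₃ : St} (h : Same σ₁ σ₂) (h' : Same σ₂ σ₃) : Same σ₁ σ₃ :=
  ⟨fun v hv => (h'.s v hv).trans (h.s v hv), fun k hk => (h'.a k hk).trans (h.a k hk),
    h'.inp.trans h.inp, h'.out.trans h.out⟩

theorem Same.set {σ σ' : St} (h : Same σ σ') {v : Var} {x : ℤ} (hv : v.temp = true) :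
    Same σ (σ'.set v x) := by
  refine ⟨fun w hw => ?_, h.a, h.inp, h.out⟩
  rw [St.set_s, if_neg (by rintro rfl; rw [hv] at hw; cases hw), h.s w hw]

theorem Same.put {σ σ' : St} (h : Same σ σ') {k : Arr} {i : ℕ} {x : ℤ} (hk : k.temp = true) :
    Same σ (σ'.put k i x) := by
  refine ⟨h.s, fun k' hk' => ?_, h.inp, h.out⟩
  rw [St.put_a_ne _ _ _ _ _ (by rintro rfl; rw [hk] at hk'; cases hk'), h.a k' hk']

/-- The constants that the program uses. -/
structure Consts (σ : St) : Prop where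
  zero : σ.s .zero = 0
  one : σ.s .one = 1
  five : σ.s .five = 5
  seven : σ.s .seven = 7

theorem Same.consts {σ σ' : St} (h : Same σ σ') (hc : Consts σ) : Consts σ' :=
  ⟨(h.s _ rfl).trans hc.zero, (h.s _ rfl).trans hc.one, (h.s _ rfl).trans hc.five,
    (h.s _ rfl).trans hc.seven⟩

/-! ### Comparison and case distinction -/

/-- The code of `ω` is the only modality code below 7, so it is singled out first; codes of finite
modalities are ordered like the modalities. -/
theorem wp_geTest {σ : St} {Q : St → ℕ → Prop} {x y : Var} {α β : ℕ∞} (hσ : Consts σ)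
    (hx : σ.s x = (Symb.dia α).code) (hy : σ.s y = (Symb.dia β).code)
    (hxd : x ≠ .d) (hyd : y ≠ .d)
    (h : ∀ e t, t ≤ 8 → Q ((σ.set .d e).set .r (if β ≤ α then 1 else 0)) t) :
    Wp (geTest x y) σ Q := by
  have hset : ∀ (σ : St) (v : Var) (a b : ℤ), (σ.set v a).set v b = σ.set v b := by
    intro σ v a b; simp [St.set]
  simp only [geTest, wp_block_cons, wp_block_nil, wp_sub, wp_ite, wp_const, wp_add, St.set_s, hx, hy,
    hσ.seven, hσ.one, hxd, hyd, hset, if_true, if_false, reduceCtorEq, Symb.code]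
  rcases eq_or_ne α ⊤ with rfl | hα
  · simpa using h _ _ (by omega)
  · lift α to ℕ using hα
    rcases eq_or_ne β ⊤ with rfl | hβ
    · simp only [ENat.natCast_ne_top, if_false, ENat.toNat_natCast, if_true, top_le_iff] at h ⊢
      rw [if_neg (by omega), if_pos (by omega)]
      exact h _ _ (by omega)
    · lift β to ℕ using hβ
      simp only [ENat.natCast_ne_top, if_false, ENat.toNat_natCast, Nat.cast_le] at h ⊢
      rw [if_neg (by omega), if_neg (by omega)]
      by_cases hle : β ≤ α
      · rw [if_pos (by omega)]
        rw [if_pos hle] at h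
        refine h _ _ ?_
        omega
      · rw [if_neg (by omega)]
        rw [if_neg hle] at h
        refine h _ _ ?_
        omega

/-- Programs for symbols that only depend on the kind of the symbol. -/
def Uniform (h : Symb → Stmt) : Prop :=
  (∀ i, h (.var i) = h (.var 0)) ∧ ∀ α, h (.dia α) = h (.dia 0)

/-- Variables are the negative codes and modalities those above 5; the rest is found by counting
down. A program text cannot depend on the index of the symbol, hence `Uniform`: the index is taken
from the register `c` at run time. -/
theorem wp_dispatch {σ : St} {Q : St → ℕ → Prop} {h : Symb → Stmt} (hh : Uniform h) (s : Symb)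
    (hσ : Consts σ) (hc : σ.s .c = s.code)
    (hs : ∀ e, Wp (h s) (σ.set .d e) fun σ' t => ∀ t', t' ≤ t + 12 → Q σ' t') :
    Wp (dispatch h) σ Q := by
  have hset : ∀ (σ : St) (v : Var) (a b : ℤ), (σ.set v a).set v b = σ.set v b := by
    intro σ v a b; simp [St.set]
  simp only [dispatch, wp_block_cons, wp_block_nil, wp_sub, wp_ite, St.set_s, hc, hset,
    hσ.zero, hσ.five, hσ.one, if_true, if_false, reduceCtorEq]
  cases s with
  | var i =>
    rw [if_pos (by simp only [Symb.code]; omega), ← hh.1 i]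
    exact (hs _).mono fun σ' t ht => ht _ (by omega)
  | dia α =>
    have hα : (5 : ℤ) < (Symb.dia α).code := by
      simp only [Symb.code]; split_ifs <;> omega
    rw [if_neg (by omega), if_pos (by omega), ← hh.2 α]
    exact (hs _).mono fun σ' t ht => ht _ (by omega)
  | _ =>
    simp only [Symb.code]
    norm_num
    exact (hs _).mono fun σ' t ht => ht _ (by omega)

end RAM

namespace RAM

open PosLogic

/-! ### The loops of the evaluation -/

/-- The source `w` must not be temporary, since the loop would overwrite it. -/
theorem wp_fill {σ : St} {w : Var} {N T : ℕ} (hσ : Consts σ) (hn : σ.s .n = N)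
    (ht : σ.s .top = T) (hw : w.temp = false) :
    Wp (fill w) σ fun σ' t => t ≤ 4 * N + 2 ∧ Same σ σ' ∧ σ'.s .top = T ∧
      ∀ y, σ'.a .vec y = if T ≤ y ∧ y < T + N then σ.s w else σ.a .vec y := by
  have hwi : w ≠ .i := by rintro rfl; cases hw
  have hwj : w ≠ .j := by rintro rfl; cases hw
  have loop := fun σ₀ h => wp_while (v := .i)
    (S := block [.sub .i .i .one, .add .j .top .i, .put .vec .j w])
    (fun q σ' => σ'.s .i = q ∧ Same σ σ' ∧ σ'.s .top = T ∧ q ≤ N ∧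
      ∀ y, σ'.a .vec y = if T + q ≤ y ∧ y < T + N then σ.s w else σ.a .vec y) 3
    (fun σ' h => by simp [h.1])
    (fun q σ' ⟨hi, hS, ht, hq, hv⟩ => by
      refine ⟨by rw [hi]; omega, ?_⟩
      have hc := hS.consts hσ
      have e : ((T : ℤ) + q).toNat = T + q := by omega
      simp [hi, ht, hc.one, hwi, hwj, e, hS.s w hw, hv]
      refine ⟨by omega, ((hS.set rfl).set rfl).put rfl, by omega, fun y => ?_⟩
      split_ifs <;> first | rfl | omega) (q := N) (σ := σ₀) h
  simp only [fill, wp_block_cons, wp_block_nil, wp_add]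
  refine (loop _ ⟨?_, ?_, ?_, le_rfl, ?_⟩).mono ?_
  · simp [hn, hσ.zero]
  · exact (Same.refl _).set rfl
  · simp [ht]
  · intro y
    rw [if_neg (by omega)]; rfl
  · rintro σ' t ⟨h₁, -, h₂, h₃, -, h₄⟩
    exact ⟨by omega, h₂, h₃, by simpa using h₄⟩

theorem wp_clear {σ : St} {N : ℕ} (hσ : Consts σ) (hn : σ.s .n = N) :
    Wp clear σ fun σ' t => t ≤ 3 * N + 2 ∧ Same σ σ' ∧ σ'.s .base = σ.s .base ∧
      σ'.s .top = σ.s .top ∧ σ'.a .vec = σ.a .vec ∧ ∀ y < N, σ'.a .er y = 0 := by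
  have loop := fun σ₀ h => wp_while (v := .i)
    (S := block [.sub .i .i .one, .put .er .i .zero])
    (fun q σ' => σ'.s .i = q ∧ Same σ σ' ∧ σ'.s .base = σ.s .base ∧ σ'.s .top = σ.s .top ∧
      σ'.a .vec = σ.a .vec ∧ ∀ y, q ≤ y → y < N → σ'.a .er y = 0) 2
    (fun σ' h => by simp [h.1])
    (fun q σ' ⟨hi, hS, hb, ht, hv, he⟩ => by
      refine ⟨by rw [hi]; omega, ?_⟩
      have hc := hS.consts hσ
      simp [hi, hb, ht, hc.one, hc.zero, hv]
      refine ⟨(hS.set rfl).put rfl, fun y h₁ h₂ h₃ => he y (by omega) h₂⟩) (q := N) (σ := σ₀) h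
  simp only [clear, wp_block_cons, wp_block_nil, wp_add]
  refine (loop _ ⟨?_, ?_, ?_, ?_, ?_, ?_⟩).mono ?_
  · simp [hn, hσ.zero]
  · exact (Same.refl _).set rfl
  · simp
  · simp
  · simp
  · intro y; omega
  · rintro σ' t ⟨h₁, -, h₂, h₃, h₄, h₅, h₆⟩
    exact ⟨by omega, h₂, h₃, h₄, h₅, fun y hy => h₆ y (Nat.zero_le _) hy⟩

/-- Truth is encoded as positivity, so it suffices to set to 0 the entries of the lower vector at
which the upper one fails. -/
theorem wp_meet {σ : St} {N T : ℕ} (hσ : Consts σ) (hn : σ.s .n = N)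
    (ht : σ.s .top = (T + N + N : ℕ)) :
    Wp meet σ fun σ' t => t ≤ 7 * N + 3 ∧ Same σ σ' ∧ σ'.s .top = (T + N : ℕ) ∧
      ∀ y, σ'.a .vec y = if T ≤ y ∧ y < T + N ∧ ¬ 0 < σ.a .vec (y + N) then 0
        else σ.a .vec y := by
  have loop := fun σ₀ h => wp_while (v := .i)
    (S := block [.sub .i .i .one, .add .j .top .i,
      .get .g .vec .j, .ite .g .skip (block [.sub .k .j .n, .put .vec .k .zero])])
    (fun q σ' => σ'.s .i = q ∧ Same σ σ' ∧ σ'.s .top = (T + N : ℕ) ∧ q ≤ N ∧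
      ∀ y, σ'.a .vec y = if T + q ≤ y ∧ y < T + N ∧ ¬ 0 < σ.a .vec (y + N) then 0
        else σ.a .vec y) 6
    (fun σ' h => by simp [h.1])
    (fun q σ' ⟨hi, hS, ht, hq, hv⟩ => by
      refine ⟨by rw [hi]; omega, ?_⟩
      have hc := hS.consts hσ
      have hn' : σ'.s .n = N := (hS.s _ rfl).trans hn
      have e : ((T : ℤ) + N + q).toNat = T + N + q := by omega
      have e' : ((T : ℤ) + N + q - N).toNat = T + q := by omega
      -- Only entries below `T + N` have changed, so the upper operand is intact.
      have e₃ : σ'.a .vec (T + N + q) = σ.a .vec (T + N + q) := by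
        rw [hv, if_neg (by omega)]
      simp [hi, ht, hc.one, hc.zero, hn', e, e', e₃]
      refine ⟨by omega, ?_⟩
      split_ifs with hg
      · refine ⟨((hS.set rfl).set rfl).set rfl, by omega, fun y => ?_⟩
        rw [hv]
        by_cases hy : y = T + q
        · subst hy
          rw [show T + q + N = T + N + q by omega]
          simp [hg]
        · exact if_congr (by omega) rfl rfl
      · refine ⟨by omega, ((((hS.set rfl).set rfl).set rfl).set rfl).put rfl,
          by omega, fun y => ?_⟩
        by_cases hy : y = T + q
        · subst hy
          rw [if_pos rfl, if_pos]
          rw [show T + q + N = T + N + q by omega]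
          exact ⟨le_rfl, by omega, not_lt.1 hg⟩
        · rw [if_neg hy, hv]
          exact if_congr (by omega) rfl rfl) (q := N) (σ := σ₀) h
  simp only [meet, wp_block_cons, wp_block_nil, wp_add, wp_sub]
  refine (loop _ ⟨?_, ?_, ?_, le_rfl, ?_⟩).mono ?_
  · simp [hn, hσ.zero]
  · exact ((Same.refl _).set rfl).set rfl
  · simp [ht, hn]
  · intro y
    rw [if_neg (by omega)]; rfl
  · rintro σ' t ⟨h₁, -, h₂, h₃, -, h₄⟩
    exact ⟨by omega, h₂, h₃, by simpa using h₄⟩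

/-- The facts are scanned from the last to the first, so the invariant speaks of the suffix `fs.drop
q`. -/
theorem wp_mark {σ : St} {N T F i : ℕ} {fs : List (ℕ × ℕ)} (hσ : Consts σ)
    (hF : fs.length = F) (hf : σ.s .f = F) (ht : σ.s .top = T) (hc : σ.s .c = (Symb.var i).code)
    (hfs : ∀ q (h : q < fs.length), σ.a .fv q = (Symb.var fs[q].2).code ∧ σ.a .fn q = fs[q].1)
    (h0 : ∀ x < N, σ.a .vec (T + x) = 0) :
    Wp mark σ fun σ' t => t ≤ 10 * F + 2 ∧ Same σ σ' ∧ σ'.s .top = T ∧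
      (∀ y < T, σ'.a .vec y = σ.a .vec y) ∧
      ∀ x < N, 0 < σ'.a .vec (T + x) ↔ (x, i) ∈ fs := by
  have loop := fun σ₀ h => wp_while (v := .i)
    (S := block [.sub .i .i .one, .get .l .fv .i, .sub .d .l .c,
    .ite .d .skip (block [.sub .d .c .l, .ite .d .skip (block
      [.get .p .fn .i, .add .j .top .p, .put .vec .j .one])])])
    (fun q σ' => σ'.s .i = q ∧ Same σ σ' ∧ σ'.s .top = T ∧ q ≤ F ∧
      (∀ y < T, σ'.a .vec y = σ.a .vec y) ∧
      ∀ x < N, 0 < σ'.a .vec (T + x) ↔ (x, i) ∈ fs.drop q) 9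
    (fun σ' h => by simp [h.1])
    (fun q σ' ⟨hi, hS, ht, hq, hv, hm⟩ => by
      refine ⟨by rw [hi]; omega, ?_⟩
      have hk := hS.consts hσ
      have hc' : σ'.s .c = -((i : ℤ) + 1) := (hS.s _ rfl).trans hc
      have hq' : q < fs.length := by omega
      have h₁ : σ'.a .fv q = -((fs[q].2 : ℤ) + 1) :=
        (congrFun (hS.a _ rfl) q).trans (hfs q hq').1
      have h₂ : σ'.a .fn q = fs[q].1 := (congrFun (hS.a _ rfl) q).trans (hfs q hq').2
      have e : ((T : ℤ) + fs[q].1).toNat = T + fs[q].1 := by omega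
      have hd := List.drop_eq_getElem_cons hq'
      simp only [wp_block_cons, wp_block_nil, wp_sub, wp_get, wp_ite, wp_skip, wp_add, wp_put,
        St.set_s, St.set_a, St.put_s, hi, hk.one, ht, hc', if_true, if_false, reduceCtorEq,
        Nat.cast_add, Nat.cast_one, add_sub_cancel_right, Int.toNat_natCast, h₁, h₂, e,
        Int.natCast_nonneg, true_and]
      have hne : ∀ hne : fs[q].2 ≠ i, ∀ x < N, 0 < σ'.a .vec (T + x) ↔ (x, i) ∈ fs.drop q := by
        intro hne x hx
        rw [hm x hx, hd, List.mem_cons]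
        refine (or_iff_right fun h => hne ?_).symm
        rw [← h]
      -- Two codes are equal exactly when both strict comparisons fail.
      split_ifs with g₁ g₂
      · exact ⟨by omega, ((hS.set rfl).set rfl).set rfl, by omega, hv,
          hne (by omega)⟩
      · exact ⟨by omega, (((hS.set rfl).set rfl).set rfl).set rfl, by omega, hv,
          hne (by omega)⟩
      · have hi' : fs[q].2 = i := by omega
        refine ⟨by omega, by omega, (((((((hS.set rfl).set rfl).set rfl).set rfl).set
          rfl).set rfl).put rfl), by omega, fun y hy => ?_, fun x hx => ?_⟩
        · rw [St.put_a_self, if_neg (by omega)]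
          exact hv y hy
        · rw [St.put_a_self, hd, List.mem_cons]
          by_cases hx' : x = fs[q].1
          · simp [hx', ← hi']
          · rw [if_neg (by omega)]
            refine (hm x hx).trans (or_iff_right fun h => hx' ?_).symm
            rw [← h]) (q := F) (σ := σ₀) h
  simp only [mark, wp_block_cons, wp_block_nil, wp_add]
  refine (loop _ ⟨?_, ?_, ?_, le_rfl, ?_, ?_⟩).mono ?_
  · simp [hf, hσ.zero]
  · exact (Same.refl _).set rfl
  · simp [ht]
  · intro y hy; rfl
  · intro x hx
    rw [List.drop_eq_nil_of_le hF.le, St.set_a, h0 x hx]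
    simp
  · rintro σ' t ⟨h₁, -, h₂, h₃, -, h₄, h₅⟩
    exact ⟨by omega, h₂, h₃, h₄, by simpa using h₅⟩

end RAM

/-! ### Processing a single node in the two passes. -/

namespace RAM

open PosLogic

/-- As `β ≤ α` is already known, the equality needed in RJ is the reverse comparison. -/
theorem wp_admissible {σ : St} {Q : St → ℕ → Prop} {rc : Bool} {α β : ℕ∞} (hσ : Consts σ)
    (hc : σ.s .c = (Symb.dia β).code) (hl : σ.s .l = (Symb.dia α).code) (hβ : β ≤ α)
    (h : ∀ e t, t ≤ 8 → Q ((σ.set .d e).set .r (if rc = true ∨ α = β then 1 else 0)) t) :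
    Wp (admissible rc) σ Q := by
  cases rc with
  | true =>
    have := h (σ.s .d) 1 (by omega)
    rw [if_pos (.inl rfl)] at this
    simpa [admissible, St.set] using this
  | false =>
    refine wp_geTest hσ hc hl (by decide) (by decide) fun e t ht => ?_
    have := h e t ht
    have hiff : (false = true ∨ α = β) ↔ α ≤ β :=
      ⟨fun h => (h.resolve_left (by decide)).le, fun h => .inr (le_antisymm h hβ)⟩
    simpa only [hiff] using this

/-- The vector at `b` carries the `G` and the array `er` the `E` of `WF.rel_of_equations`. This is
the contribution of `G q` to both values at the parent; entries are only ever raised. -/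
theorem wp_propagate {σ : St} {rc : Bool} {α β : ℕ∞} {b p q : ℕ} (hσ : Consts σ)
    (hc : σ.s .c = (Symb.dia β).code) (hl : σ.s .l = (Symb.dia α).code) (hβ : β ≤ α)
    (hi : σ.s .i = q) (hb : σ.s .base = b) (hp : σ.s .p = p) :
    Wp (propagate rc) σ fun σ' t => t ≤ 16 ∧ Same σ σ' ∧ σ'.s .i = q ∧ σ'.s .p = p ∧
      σ'.s .base = b ∧ σ'.s .top = σ.s .top ∧
      (∀ y, 0 < σ'.a .vec y ↔ 0 < σ.a .vec y ∨ (y = b + p ∧ 0 < σ.a .vec (b + q))) ∧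
      (∀ y, 0 < σ'.a .er y ↔
        0 < σ.a .er y ∨ (y = p ∧ (rc = true ∨ α = β) ∧ 0 < σ.a .vec (b + q))) := by
  have e₁ : ((b : ℤ) + q).toNat = b + q := by omega
  have e₂ : ((b : ℤ) + p).toNat = b + p := by omega
  have hS := Same.refl σ
  simp only [propagate, wp_block_cons, wp_block_nil, wp_get, wp_ite, wp_skip, wp_add, wp_put,
    St.set_s, St.set_a, hi, hb, hp, if_true, if_false, reduceCtorEq, e₁, e₂]
  refine ⟨by omega, ?_⟩
  split_ifs with hg
  · refine ⟨by omega, wp_admissible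
      ((((hS.set rfl).set rfl).set rfl).put rfl |>.consts hσ) (α := α) (β := β) ?_ ?_ hβ ?_⟩
    · simp [hc]
    · simp [hl]
    · intro e t ht
      have hS' := fun x₁ x₂ x₃ x₄ x₅ => ((((((hS.set (v := .j) (x := (b : ℤ) + q) rfl).set
        (v := .g) (x := x₁) rfl).set (v := .j) (x := x₂) rfl).put (k := .vec) (i := b + p)
        (x := x₃) rfl).set (v := .d) (x := x₄) rfl).set (v := .r) (x := x₅) rfl)
      by_cases ha : rc = true ∨ α = β
      · simp only [ha, if_true, St.set_s, St.put_s, reduceCtorEq, if_false, hp, hσ.one, zero_lt_one,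
          Int.toNat_natCast, hb]
        refine ⟨by omega, by omega, (hS' _ _ _ _ _).put rfl, ?_⟩
        simp only [hi, true_and]
        constructor
        · intro y
          rw [St.put_a_ne _ _ _ _ _ (by decide)]
          simp only [St.set_a, St.put_a_self]
          split_ifs with hy <;> simp [hy, hg]
        · intro y
          rw [St.put_a_self]
          split_ifs with hy
          · simp [hy, hg]
          · simp [hy]
      · simp only [ha, if_false, St.set_s, St.put_s, reduceCtorEq, if_true, hp, hσ.one,
          Int.toNat_natCast, hb, lt_irrefl]
        refine ⟨by omega, hS' _ _ _ _ _, ?_⟩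
        simp only [hi, true_and]
        constructor
        · intro y
          simp only [St.set_a, St.put_a_self]
          split_ifs with hy <;> simp [hy, hg]
        · intro y
          simp
  · refine ⟨by omega, (hS.set rfl).set rfl, ?_⟩
    simp [hg]

theorem wp_downStep {σ : St} {rc : Bool} {α β : ℕ∞} {b p q : ℕ} (hσ : Consts σ)
    (hc : σ.s .c = (Symb.dia β).code) (hl : σ.a .lab q = (Symb.dia α).code)
    (hp : σ.a .par q = p) (hpq : p < q) (hi : σ.s .i = q) (hb : σ.s .base = b) :
    Wp (downStep rc) σ fun σ' t => t ≤ 40 ∧ Same σ σ' ∧ σ'.s .i = q - 1 ∧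
      σ'.s .base = b ∧ σ'.s .top = σ.s .top ∧
      (∀ y, 0 < σ'.a .vec y ↔ 0 < σ.a .vec y ∨ (y = b + p ∧ β ≤ α ∧ 0 < σ.a .vec (b + q))) ∧
      (∀ y, 0 < σ'.a .er y ↔ 0 < σ.a .er y ∨ (y = p ∧ β ≤ α ∧
        (0 < σ.a .er q ∨ (rc = true ∨ α = β) ∧ 0 < σ.a .vec (b + q)))) := by
  have hS := Same.refl σ
  simp only [downStep, wp_block_cons, wp_block_nil, wp_get, wp_ite, wp_skip, wp_sub,
    hi, Int.toNat_natCast, hl]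
  refine ⟨by omega, wp_geTest ((hS.set rfl).consts hσ) (α := α) (β := β) (by simp) (by simp [hc])
    (by decide) (by decide) fun e t ht => ?_⟩
  by_cases hβ : β ≤ α
  · simp only [hβ, if_true, St.set_s, reduceCtorEq, if_false, hi, zero_lt_one, St.set_a,
      Int.toNat_natCast, hp, Int.natCast_nonneg, true_and]
    have hS₁ := fun x₁ x₂ x₃ x₄ => ((((hS.set (v := .l) (x := x₁) rfl).set (v := .d) (x := x₂) rfl).set
      (v := .r) (x := x₃) rfl).set (v := .p) (x := x₄) rfl)
    refine (wp_propagate (α := α) (β := β) (b := b) (p := p) (q := q) ((hS₁ _ _ _ _).consts hσ)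
      ?_ ?_ hβ ?_ ?_ ?_).mono ?_
    · simp [hc]
    · simp
    · simp [hi]
    · simp [hb]
    · simp
    · rintro σ' t' ⟨ht', hS', hi', hp', hb', htop', hv', he'⟩
      replace hS' := (hS₁ _ _ _ _).trans hS'
      simp only [St.set_a, St.set_s, reduceCtorEq, if_false] at hv' he' htop'
      simp only [hi', hp', Int.toNat_natCast, Int.natCast_nonneg, true_and, St.set_s,
        reduceCtorEq, if_false, wp_put]
      have hone := (hS'.consts hσ).one
      -- The propagation only touches `er` at `p`, and `p < q`.
      have hq : 0 < σ'.a .er q ↔ 0 < σ.a .er q := by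
        rw [he' q]
        exact or_iff_left fun h => hpq.ne' h.1
      split_ifs with hg
      · rw [hq] at hg
        refine ⟨by omega, ((hS'.set rfl).put rfl).set rfl, ?_⟩
        simp only [St.set_s, St.put_s, reduceCtorEq, if_false, hi', hone, hb', htop',
          true_and]
        constructor
        · intro y
          rw [St.put_a_ne _ _ _ _ _ (by decide)]
          exact hv' y
        · intro y
          rw [St.put_a_self]
          split_ifs with hy
          · simp [hy, hg]
          · rw [St.set_a, he']
            simp [hy]
      · rw [hq] at hg
        refine ⟨by omega, (hS'.set rfl).set rfl, ?_⟩
        simp only [hone, hb', htop',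
          true_and]
        refine ⟨hv', fun y => ?_⟩
        rw [he']
        simp [hg]
  · simp only [hβ, St.set_s, reduceCtorEq, if_false, hi, lt_irrefl, if_true, hσ.one]
    refine ⟨by omega, (((hS.set rfl).set rfl).set rfl).set rfl, ?_⟩
    simp [hb]

/-- The array `er` is turned from `E` into `F` in place, and the final value at `q` is copied to the
vector. -/
theorem wp_upStep {σ : St} {α β : ℕ∞} {b p q : ℕ} (hσ : Consts σ)
    (hc : σ.s .c = (Symb.dia β).code) (hl : 0 < q → σ.a .lab q = (Symb.dia α).code)
    (hp : 0 < q → σ.a .par q = p) (hi : σ.s .i = q) (hb : σ.s .base = b) :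
    Wp upStep σ fun σ' t => t ≤ 40 ∧ Same σ σ' ∧ σ'.s .i = q + 1 ∧ σ'.s .k = σ.s .k - 1 ∧
      σ'.s .base = b ∧ σ'.s .top = σ.s .top ∧
      (∀ y, 0 < σ'.a .er y ↔ 0 < σ.a .er y ∨ (y = q ∧ 0 < q ∧ β < α ∧ 0 < σ.a .er p)) ∧
      (∀ y, y ≠ b + q → σ'.a .vec y = σ.a .vec y) ∧ σ'.a .vec (b + q) = σ'.a .er q := by
  have hS := Same.refl σ
  have e₁ : ((b : ℤ) + q).toNat = b + q := by omega
  -- All branches share the remaining instructions.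
  have tail : ∀ (σ' : St) (t : ℕ), t ≤ 20 → Same σ σ' → σ'.s .i = q → σ'.s .k = σ.s .k →
      σ'.s .base = b → σ'.s .top = σ.s .top → σ'.a .vec = σ.a .vec →
      (∀ y, 0 < σ'.a .er y ↔ 0 < σ.a .er y ∨ (y = q ∧ 0 < q ∧ β < α ∧ 0 < σ.a .er p)) →
      Wp (block [.get .g .er .i, .add .j .base .i, .put .vec .j .g, .add .i .i .one,
        .sub .k .k .one]) σ' fun σ'' t' => t + t' ≤ 40 ∧ Same σ σ'' ∧ σ''.s .i = q + 1 ∧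
      σ''.s .k = σ.s .k - 1 ∧ σ''.s .base = b ∧ σ''.s .top = σ.s .top ∧
      (∀ y, 0 < σ''.a .er y ↔ 0 < σ.a .er y ∨ (y = q ∧ 0 < q ∧ β < α ∧ 0 < σ.a .er p)) ∧
      (∀ y, y ≠ b + q → σ''.a .vec y = σ.a .vec y) ∧ σ''.a .vec (b + q) = σ''.a .er q := by
    intro σ' t ht hS' hi' hk' hb' htop' hv' he'
    simp only [wp_block_cons, wp_block_nil, wp_get, wp_add, wp_put, wp_sub, hi', hb', e₁,
      Int.toNat_natCast, Int.natCast_nonneg, true_and, St.set_s, St.put_s, St.set_a, if_true,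
      reduceCtorEq, if_false, (hS'.consts hσ).one, hk', htop']
    refine ⟨by omega, by omega, (((((hS'.set rfl).set rfl).put rfl).set rfl).set rfl), ?_, ?_, ?_⟩
    · intro y
      rw [St.put_a_ne _ _ _ _ _ (by decide)]
      exact he' y
    · intro y hy
      rw [St.put_a_self, if_neg hy, ← hv']; rfl
    · rw [St.put_a_self, if_pos rfl, St.put_a_ne _ _ _ _ _ (by decide)]; rfl
  rw [upStep, wp_block_cons, wp_ite]
  split_ifs with h0
  · have hq : 0 < q := by omega
    simp only [wp_block_cons (S := .get .l .lab .i), wp_get, hi, Int.toNat_natCast, hl hq]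
    refine ⟨by omega, ?_⟩
    rw [wp_block_cons]
    refine wp_geTest ((hS.set rfl).consts hσ) (α := β) (β := α) (by simp [hc]) (by simp)
      (by decide) (by decide) fun e t ht => ?_
    by_cases hβ : α ≤ β
    · simp only [hβ, if_true, St.set_s, wp_block_cons (S := .ite _ _ _), wp_block_nil, wp_ite,
        wp_skip, zero_lt_one]
      refine (tail _ (1 + (t + (0 + 1 + 0)) + 1) (by omega) (((hS.set rfl).set rfl).set rfl)
        (by simp [hi]) (by simp) (by simp [hb]) (by simp) (by simp) ?_)
      simp [hβ]
    · simp only [hβ, if_false, St.set_s, wp_block_cons (S := .ite _ _ _),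
        wp_block_cons (S := .get .p .par .i), wp_block_cons (S := .get .g .er .p), wp_block_nil, wp_ite, if_true,
        lt_irrefl, reduceCtorEq, hi, hp hq, wp_get, Int.toNat_natCast, Int.natCast_nonneg, true_and,
        wp_put, wp_skip, St.set_a, hσ.one]
      split_ifs with hg
      · refine tail _ _ ?_ ?_ ?_ ?_ ?_ ?_ ?_ ?_
        · omega
        · exact (((((hS.set rfl).set rfl).set rfl).set rfl).set rfl).put rfl
        · simp [hi]
        · simp
        · simp [hb]
        · simp
        · simp
        · intro y
          rw [St.put_a_self]
          split_ifs with hy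
          · simp [hy, hq, not_le.1 hβ, hg]
          · simp [hy]
      · refine tail _ _ ?_ ?_ ?_ ?_ ?_ ?_ ?_ ?_
        · omega
        · exact ((((hS.set rfl).set rfl).set rfl).set rfl).set rfl
        · simp [hi]
        · simp
        · simp [hb]
        · simp
        · simp
        · simp [hg]
  · have hq : q = 0 := by omega
    rw [wp_skip]
    exact tail _ _ (by omega) hS hi rfl hb rfl rfl (by simp [hq])

end RAM

namespace RAM

open PosLogic

/-! ### The passes through the tree -/

/-- The tree `T` is stored in the state `σ`. -/
structure Stores (σ : St) (T : Tree) : Prop where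
  n : σ.s .n = T.n
  par : ∀ c, 0 < c → c < T.n → σ.a .par c = T.par c
  lab : ∀ c, 0 < c → c < T.n → σ.a .lab c = (Symb.dia (T.lab c)).code

theorem Same.stores {σ σ' : St} {T : Tree} (h : Same σ σ') (hT : Stores σ T) : Stores σ' T :=
  ⟨(h.s _ rfl).trans hT.n, fun c h₁ h₂ => (congrFun (h.a _ rfl) c).trans (hT.par c h₁ h₂),
    fun c h₁ h₂ => (congrFun (h.a _ rfl) c).trans (hT.lab c h₁ h₂)⟩

/-- Nodes are visited in decreasing order, so the values at a node are final when it is visited. The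
invariant is the system of equations restricted to children `c > q`. The loop runs `T.n - 1` times,
as the root has no parent edge. -/
theorem wp_downPass {σ : St} {T : Tree} {rc : Bool} {β : ℕ∞} {b : ℕ} (hσ : Consts σ)
    (hT : Stores σ T) (hw : T.WF) (hn : 0 < T.n) (hc : σ.s .c = (Symb.dia β).code)
    (hb : σ.s .base = b) (he : ∀ x < T.n, σ.a .er x = 0) :
    Wp (downPass rc) σ fun σ' t => t ≤ 41 * T.n + 2 ∧ Same σ σ' ∧ σ'.s .base = b ∧
      σ'.s .top = σ.s .top ∧ (∀ y < b, 0 < σ'.a .vec y ↔ 0 < σ.a .vec y) ∧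
      (∀ x < T.n, 0 < σ'.a .vec (b + x) ↔ 0 < σ.a .vec (b + x) ∨
        ∃ c, 0 < c ∧ c < T.n ∧ T.par c = x ∧ β ≤ T.lab c ∧ 0 < σ'.a .vec (b + c)) ∧
      (∀ x < T.n, 0 < σ'.a .er x ↔
        ∃ c, 0 < c ∧ c < T.n ∧ T.par c = x ∧ β ≤ T.lab c ∧
          (0 < σ'.a .er c ∨ (rc = true ∨ T.lab c = β) ∧ 0 < σ'.a .vec (b + c))) := by
  have loop := fun σ₀ h => wp_while (v := .i) (S := downStep rc)
    (fun q σ' => σ'.s .i = q ∧ q < T.n ∧ Same σ σ' ∧ σ'.s .base = b ∧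
      σ'.s .top = σ.s .top ∧ (∀ y < b, 0 < σ'.a .vec y ↔ 0 < σ.a .vec y) ∧
      (∀ x < T.n, 0 < σ'.a .vec (b + x) ↔ 0 < σ.a .vec (b + x) ∨
        ∃ c, q < c ∧ c < T.n ∧ T.par c = x ∧ β ≤ T.lab c ∧ 0 < σ'.a .vec (b + c)) ∧
      (∀ x < T.n, 0 < σ'.a .er x ↔
        ∃ c, q < c ∧ c < T.n ∧ T.par c = x ∧ β ≤ T.lab c ∧
          (0 < σ'.a .er c ∨ (rc = true ∨ T.lab c = β) ∧ 0 < σ'.a .vec (b + c)))) 40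
    (fun σ' h => by simp [h.1])
    (fun q σ' ⟨hi, hq, hS, hb, htop, hlow, hG, hE⟩ => by
      have hp := hw (q + 1) (by omega) hq
      have hT' := hS.stores hT
      refine ⟨by rw [hi]; omega, (wp_downStep (hS.consts hσ) ((hS.s _ rfl).trans hc)
        (hT'.lab _ (by omega) hq) (hT'.par _ (by omega) hq) hp hi hb).mono ?_⟩
      rintro σ'' t ⟨ht, hS', hi', hb', htop', hv, he⟩
      -- The step for `q + 1` only changes entries of its parent, whose number is at most `q`.
      have hv' : ∀ c, q < c → (0 < σ''.a .vec (b + c) ↔ 0 < σ'.a .vec (b + c)) := fun c hc => by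
        rw [hv]; exact or_iff_left fun h => by omega
      have he' : ∀ c, q < c → (0 < σ''.a .er c ↔ 0 < σ'.a .er c) := fun c hc => by
        rw [he]; exact or_iff_left fun h => by omega
      refine ⟨ht, by rw [hi']; push_cast; ring, by omega, hS.trans hS', hb', htop'.trans htop,
        fun y hy => ?_, fun x hx => ?_, fun x hx => ?_⟩
      · rw [hv, ← hlow y hy]
        exact or_iff_left fun h => by omega
      · rw [hv, hG x hx, or_assoc]
        refine or_congr_right ⟨?_, ?_⟩
        · rintro (⟨c, h₁, h₂, h₃, h₄, h₅⟩ | ⟨h₁, h₂, h₃⟩)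
          · exact ⟨c, by omega, h₂, h₃, h₄, (hv' c (by omega)).2 h₅⟩
          · exact ⟨q + 1, by omega, hq, by omega, h₂, (hv' _ (by omega)).2 h₃⟩
        · rintro ⟨c, h₁, h₂, h₃, h₄, h₅⟩
          rw [hv' c h₁] at h₅
          rcases (Nat.succ_le_of_lt h₁).eq_or_lt with rfl | h₁
          · exact .inr ⟨by rw [← h₃], h₄, h₅⟩
          · exact .inl ⟨c, h₁, h₂, h₃, h₄, h₅⟩
      · rw [he, hE x hx]
        constructor
        · rintro (⟨c, h₁, h₂, h₃, h₄, h₅⟩ | ⟨h₁, h₂, h₃⟩)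
          · exact ⟨c, by omega, h₂, h₃, h₄, by rwa [hv' c (by omega), he' c (by omega)]⟩
          · exact ⟨q + 1, by omega, hq, h₁.symm, h₂,
              by rwa [hv' _ (Nat.lt_succ_self q), he' _ (Nat.lt_succ_self q)]⟩
        · rintro ⟨c, h₁, h₂, h₃, h₄, h₅⟩
          rw [hv' c h₁, he' c h₁] at h₅
          rcases (Nat.succ_le_of_lt h₁).eq_or_lt with rfl | h₁
          · exact .inr ⟨h₃.symm, h₄, h₅⟩
          · exact .inl ⟨c, h₁, h₂, h₃, h₄, h₅⟩) (q := T.n - 1) (σ := σ₀) h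
  simp only [downPass, wp_block_cons, wp_block_nil, wp_sub]
  refine (loop _ ⟨?_, by omega, (Same.refl _).set rfl, ?_, ?_, fun _ _ => Iff.rfl,
    fun x hx => ?_, fun x hx => ?_⟩).mono ?_
  · rw [St.set_s, if_pos rfl, hT.n, hσ.one]; omega
  · simp [hb]
  · simp
  · refine (or_iff_left ?_).symm
    rintro ⟨c, h₁, h₂, -⟩
    omega
  · rw [St.set_a, he x hx]
    refine iff_of_false (lt_irrefl _) ?_
    rintro ⟨c, h₁, h₂, -⟩
    omega
  · rintro σ' t ⟨h₁, -, -, h₂⟩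
    exact ⟨by omega, h₂⟩

/-- Below `i` the array `er` holds `F`, from `i` on still `E`; the parent of `i` lies in the
finished part. The node counts up, so a separate counter `k` controls the loop. -/
theorem wp_upPass {σ : St} {T : Tree} {β : ℕ∞} {b : ℕ} (hσ : Consts σ)
    (hT : Stores σ T) (hw : T.WF) (hc : σ.s .c = (Symb.dia β).code) (hb : σ.s .base = b) :
    Wp upPass σ fun σ' t => t ≤ 41 * T.n + 3 ∧ Same σ σ' ∧ σ'.s .top = σ.s .top ∧
      (∀ y < b, σ'.a .vec y = σ.a .vec y) ∧
      (∀ x < T.n, 0 < σ'.a .vec (b + x) ↔ 0 < σ.a .er x ∨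
        (0 < x ∧ β < T.lab x ∧ 0 < σ'.a .vec (b + T.par x))) := by
  have loop := fun σ₀ h => wp_while (v := .k) (S := upStep)
    (fun q σ' => ∃ i, i + q = T.n ∧ σ'.s .k = q ∧ σ'.s .i = i ∧ Same σ σ' ∧ σ'.s .base = b ∧
      σ'.s .top = σ.s .top ∧ (∀ y < b, σ'.a .vec y = σ.a .vec y) ∧
      (∀ x < i, 0 < σ'.a .vec (b + x) ↔ 0 < σ'.a .er x) ∧
      (∀ x < i, 0 < σ'.a .er x ↔ 0 < σ.a .er x ∨
        (0 < x ∧ β < T.lab x ∧ 0 < σ'.a .er (T.par x))) ∧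
      (∀ x, i ≤ x → (0 < σ'.a .er x ↔ 0 < σ.a .er x))) 40
    (fun σ' ⟨_, _, h, _⟩ => by simp [h])
    (fun q σ' ⟨i, hiq, hk, hi, hS, hb, htop, hlow, hv, hF, hE⟩ => by
      have hT' := hS.stores hT
      refine ⟨by rw [hk]; omega, (wp_upStep (α := T.lab i) (β := β) (p := T.par i)
        (hS.consts hσ) ((hS.s _ rfl).trans hc)
        (fun h => hT'.lab _ h (by omega)) (fun h => hT'.par _ h (by omega)) hi hb).mono ?_⟩
      rintro σ'' t ⟨ht, hS', hi', hk', hb', htop', he, hv₁, hv₂⟩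
      have he' : ∀ x, x ≠ i → (0 < σ''.a .er x ↔ 0 < σ'.a .er x) := fun x hx => by
        rw [he]; exact or_iff_left fun h => hx h.1
      refine ⟨ht, i + 1, by omega, by rw [hk', hk]; push_cast; ring, by rw [hi']; push_cast; rfl,
        hS.trans hS', hb', htop'.trans htop, fun y hy => ?_, fun x hx => ?_, fun x hx => ?_,
        fun x hx => ?_⟩
      · rw [hv₁ y (by omega), hlow y hy]
      · rcases Nat.lt_succ_iff_lt_or_eq.1 hx with hx | rfl
        · rw [hv₁ _ (by omega), hv x hx, he' x hx.ne]
        · rw [hv₂]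
      · rcases Nat.lt_succ_iff_lt_or_eq.1 hx with hx | rfl
        · rw [he' x hx.ne, hF x hx]
          refine or_congr_right (and_congr_right fun h₀ => and_congr_right fun _ => ?_)
          have := hw x h₀ (by omega)
          exact (he' _ (by omega)).symm
        · rw [he, hE x le_rfl]
          refine or_congr_right ?_
          simp only [true_and]
          refine and_congr_right fun h₀ => and_congr_right fun _ => ?_
          have := hw x h₀ (by omega)
          exact (he' _ (by omega)).symm
      · rw [he' x (by omega), hE x (by omega)]) (q := T.n) (σ := σ₀) h
  simp only [upPass, wp_block_cons, wp_block_nil, wp_add, wp_const]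
  refine (loop _ ⟨0, by omega, ?_, ?_, ((Same.refl _).set rfl).set rfl, ?_, ?_, fun _ _ => rfl,
    fun x hx => by omega, fun x hx => by omega, fun _ _ => Iff.rfl⟩).mono ?_
  · simp [hT.n, hσ.zero]
  · simp
  · simp [hb]
  · simp
  · rintro σ' t ⟨h₁, i, hi, -, -, h₂, -, h₃, h₄, h₅, h₆, -⟩
    obtain rfl : i = T.n := by omega
    refine ⟨by omega, h₂, by simpa using h₃, h₄, fun x hx => ?_⟩
    rw [h₅ x hx, h₆ x hx]
    refine or_congr_right (and_congr_right fun h₀ => and_congr_right fun _ => ?_)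
    exact (h₅ _ ((hw x h₀ hx).trans hx)).symm

/-! ### The evaluation of the right-hand side -/

/-- The array `v` holds the truth values of the formulas of a stack. -/
def VecRep (T : Tree) (rc : Bool) (v : ℕ → ℤ) : List Formula → Prop
  | [] => True
  | A :: l => (∀ x < T.n, 0 < v (l.length * T.n + x) ↔ T.Sat rc A x) ∧ VecRep T rc v l

theorem VecRep.congr {T : Tree} {rc : Bool} {v v' : ℕ → ℤ} {l : List Formula}
    (h : VecRep T rc v l) (hv : ∀ y < l.length * T.n, 0 < v' y ↔ 0 < v y) :
    VecRep T rc v' l := by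
  induction l with
  | nil => trivial
  | cons A l ih =>
    rw [List.length_cons, Nat.succ_mul] at hv
    exact ⟨fun x hx => (hv _ (by omega)).trans (h.1 x hx), ih h.2 fun y hy => hv y (by omega)⟩

/-- The stack is large enough for the symbol. -/
def Fits : Symb → List Formula → Prop
  | .lpar, l => 2 ≤ l.length
  | .dia _, l => 1 ≤ l.length
  | _, _ => True

/-- The stack is large enough for all symbols of a string that is read from right to left. -/
def AllFits : List Symb → List Formula → Prop
  | [], _ => True
  | s :: L, l => Fits s (L.foldr stackStep l) ∧ AllFits L l

theorem allFits_append {L L' : List Symb} {l : List Formula} :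
    AllFits (L ++ L') l ↔ AllFits L (L'.foldr stackStep l) ∧ AllFits L' l := by
  induction L with
  | nil => simp [AllFits]
  | cons s L ih => simp [AllFits, ih, and_assoc]

/-- This guarantees that an opening bracket or a modality never falls into the default clause of
`stackStep`. -/
theorem allFits_symbols (B : Formula) (l : List Formula) : AllFits B.symbols l := by
  induction B generalizing l with
  | var i => exact ⟨trivial, trivial⟩
  | top => exact ⟨trivial, trivial⟩
  | and A B ihA ihB =>
    simp [Formula.symbols, AllFits, allFits_append, ihA, ihB, Fits, foldr_stackStep, stackStep]
  | dia α A ih => simp [Formula.symbols, AllFits, ih, Fits, foldr_stackStep]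

/-- The tree, the list of facts, and the right-hand side `L` are stored in `σ`. -/
structure Ready (σ : St) (R : Reader) (L : List Symb) : Prop where
  consts : Consts σ
  stores : Stores σ R.tree
  f : σ.s .f = R.facts.length
  facts : ∀ q (h : q < R.facts.length),
    σ.a .fv q = (Symb.var R.facts[q].2).code ∧ σ.a .fn q = R.facts[q].1
  inb : ∀ q (h : q < L.length), σ.a .inb q = L[q].code
  out : σ.out = []

theorem Same.ready {σ σ' : St} {R : Reader} {L : List Symb} (h : Same σ σ') (hR : Ready σ R L) :
    Ready σ' R L :=
  ⟨h.consts hR.consts, h.stores hR.stores, (h.s _ rfl).trans hR.f,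
    fun q hq => by rw [h.a _ rfl, h.a _ rfl]; exact hR.facts q hq,
    fun q hq => by rw [h.a _ rfl]; exact hR.inb q hq, h.out.trans hR.out⟩

theorem uniform_evalStep (rc : Bool) : Uniform (evalStep rc) := ⟨fun _ => rfl, fun _ => rfl⟩

theorem wp_evalStep {σ : St} {R : Reader} {L : List Symb} {rc : Bool} {s : Symb}
    {l : List Formula} (hσ : Ready σ R L) (hR : R.Good) (hc : σ.s .c = s.code)
    (htop : σ.s .top = (l.length * R.n : ℕ)) (hl : VecRep R.tree rc (σ.a .vec) l)
    (hs : Fits s l) :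
    Wp (evalStep rc s) σ fun σ' t => t ≤ 100 * (R.n + R.facts.length) + 10 ∧ Same σ σ' ∧
      σ'.s .top = ((stackStep s l).length * R.n : ℕ) ∧
      VecRep R.tree rc (σ'.a .vec) (stackStep s l) := by
  have hk := hσ.consts
  have hn : σ.s .n = R.n := hσ.stores.n
  cases s with
  | var i =>
    simp only [evalStep, wp_block_cons, wp_block_nil, wp_add]
    refine (wp_fill hk hn htop rfl).mono fun σ₁ t₁ ⟨ht₁, hS₁, htop₁, hv₁⟩ => ?_
    have hσ₁ := hS₁.ready hσ
    refine (wp_mark (N := R.n) hσ₁.consts rfl hσ₁.f htop₁ ((hS₁.s _ rfl).trans hc) hσ₁.facts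
      fun x hx => ?_).mono fun σ₂ t₂ ⟨ht₂, hS₂, htop₂, hlow₂, hv₂⟩ => ?_
    · rw [hv₁, if_pos (by omega), hk.zero]
    · refine ⟨by omega, (hS₁.trans hS₂).set rfl, ?_, hv₂, hl.congr fun y hy => ?_⟩
      · rw [St.set_s, if_pos rfl, htop₂, hS₂.s _ rfl, hS₁.s _ rfl, hn]
        simp [stackStep]; ring
      · rw [St.set_a, hlow₂ y hy, hv₁, if_neg (by simp only [Reader.tree] at hy; omega)]
  | top =>
    simp only [evalStep, wp_block_cons, wp_block_nil, wp_add]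
    refine (wp_fill hk hn htop rfl).mono fun σ₁ t₁ ⟨ht₁, hS₁, htop₁, hv₁⟩ => ?_
    refine ⟨by omega, hS₁.set rfl, ?_, fun x hx => ?_, hl.congr fun y hy => ?_⟩
    · rw [St.set_s, if_pos rfl, htop₁, hS₁.s _ rfl, hn]
      simp [stackStep]; ring
    · have hx' : x < R.n := hx
      have h₁ : σ₁.a .vec (l.length * R.n + x) = 1 := by
        rw [hv₁, if_pos (by omega), hk.one]
      exact iff_of_true (by rw [St.set_a]; exact h₁ ▸ zero_lt_one) trivial
    · rw [St.set_a, hv₁, if_neg (by simp only [Reader.tree] at hy; omega)]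
  | and => exact wp_skip.2 ⟨by omega, Same.refl _, htop, hl⟩
  | rpar => exact wp_skip.2 ⟨by omega, Same.refl _, htop, hl⟩
  | turnstile => exact wp_skip.2 ⟨by omega, Same.refl _, htop, hl⟩
  | lpar =>
    match l, hs with
    | A :: B :: l, _ =>
      obtain ⟨hA, hB, hl⟩ := hl
      simp only [List.length_cons, Nat.succ_mul] at htop hA
      refine (wp_meet hk hn htop).mono fun σ₁ t₁ ⟨ht₁, hS₁, htop₁, hv₁⟩ =>
        ⟨by omega, hS₁, ?_, fun x hx => ?_, hl.congr fun y hy => ?_⟩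
      · rw [htop₁]; simp [stackStep]; ring
      · simp only [Reader.tree] at hx hA hB ⊢
        have hA' := hA x hx
        -- The left conjunct `A` is pushed last, so its vector is the upper one; the result replaces
        -- that of `B`.
        rw [show l.length * R.n + R.n + x = l.length * R.n + x + R.n by omega] at hA'
        rw [hv₁, Tree.Sat, ← hA', ← hB x hx]
        split_ifs with h
        · exact iff_of_false (lt_irrefl _) fun h' => h.2.2 h'.1
        · refine (and_iff_right ?_).symm
          by_contra h'
          exact h ⟨by omega, by omega, h'⟩
      · simp only [Reader.tree] at hy
        rw [hv₁, if_neg (by omega)]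
  | dia β =>
    match l, hs with
    | A :: l, _ =>
      obtain ⟨hA, hl⟩ := hl
      simp only [List.length_cons, Nat.succ_mul] at htop
      simp only [evalStep, wp_block_cons, wp_block_nil, wp_sub]
      set σ₀ := σ.set .base (σ.s .top - σ.s .n) with hσ₀
      have hS₀ : Same σ σ₀ := (Same.refl σ).set rfl
      have hb₀ : σ₀.s .base = (l.length * R.n : ℕ) := by
        rw [hσ₀, St.set_s, if_pos rfl, htop, hn]; push_cast; ring
      refine (wp_clear (hS₀.consts hk) ((hS₀.s _ rfl).trans hn)).mono
        fun σ₁ t₁ ⟨ht₁, hS₁, hb₁, htop₁, hv₁, he₁⟩ => ?_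
      replace hS₁ := hS₀.trans hS₁
      refine (wp_downPass (T := R.tree) (rc := rc) (hS₁.consts hk) (hS₁.stores hσ.stores) hR.wf
        (Nat.zero_lt_of_lt hR.cur_lt) ((hS₁.s _ rfl).trans hc) (hb₁.trans hb₀) he₁).mono
        fun σ₂ t₂ ⟨ht₂, hS₂, hb₂, htop₂, hlow₂, hG, hE⟩ => ?_
      replace hS₂ := hS₁.trans hS₂
      refine (wp_upPass (T := R.tree) (hS₂.consts hk) (hS₂.stores hσ.stores) hR.wf
        ((hS₂.s _ rfl).trans hc) hb₂).mono
        fun σ₃ t₃ ⟨ht₃, hS₃, htop₃, hlow₃, hF⟩ => ?_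
      have hv₀ : σ₁.a .vec = σ.a .vec := hv₁
      refine ⟨by simp only [Reader.tree] at ht₂ ht₃; omega, hS₂.trans hS₃, ?_, ?_,
        hl.congr fun y hy => ?_⟩
      · rw [htop₃, htop₂, htop₁, hσ₀, St.set_s, if_neg (by decide), htop]
        simp [stackStep]; ring
      -- The two passes have established exactly the three systems of equations.
      · refine hR.wf.rel_of_equations
          (G := fun x => 0 < σ₂.a .vec (l.length * R.n + x)) (E := fun x => 0 < σ₂.a .er x)
          (fun x hx => ?_) hE hF
        rw [hG x hx, hv₀]
        exact or_congr_left (hA x hx)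
      · rw [hlow₃ y hy, hlow₂ y hy, hv₀]

end RAM

/-! ### The loop over the right-hand side, and its input. -/

namespace RAM

open PosLogic

/-- After the suffix `L.drop q` has been processed, the vectors represent the formula stack obtained
from it. At the end `B` is alone on the stack, and entry 0 is its value at the root. -/
theorem wp_evalRight {σ : St} {R : Reader} {B : Formula} {rc : Bool}
    (hσ : Ready σ R B.symbols) (hR : R.Good) (hm : σ.s .m = B.length) (htop : σ.s .top = 0) :
    Wp (evalRight rc) σ fun σ' t =>
      t ≤ B.length * (100 * (R.n + R.facts.length) + 25) + 1 ∧ Ready σ' R B.symbols ∧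
      (0 < σ'.a .vec 0 ↔ R.tree.Sat rc B 0) := by
  set L := B.symbols with hL
  have hfit : ∀ q, AllFits (L.drop q) [] := fun q => by
    have := allFits_symbols B []
    rw [← hL, ← List.take_append_drop q L, allFits_append] at this
    exact this.2
  refine (wp_while (v := .m) (fun q σ' => σ'.s .m = q ∧ q ≤ L.length ∧ Ready σ' R L ∧
    σ'.s .top = (((L.drop q).foldr stackStep []).length * R.n : ℕ) ∧
    VecRep R.tree rc (σ'.a .vec) ((L.drop q).foldr stackStep []))
    (100 * (R.n + R.facts.length) + 24) (fun σ' h => by simp [h.1]) ?_ (q := L.length)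
    ⟨hm, le_rfl, hσ, by simp [htop], by simp [VecRep]⟩).mono ?_
  · rintro q σ' ⟨hm, hq, hR', htop, hv⟩
    refine ⟨by rw [hm]; omega, ?_⟩
    have hd := List.drop_eq_getElem_cons (show q < L.length from hq)
    have hfit' := hfit q
    rw [hd] at hfit' ⊢
    set l := (L.drop (q + 1)).foldr stackStep [] with hl
    have e' : σ'.s .m - σ'.s .one = q := by rw [hm, hR'.consts.one]; omega
    simp only [wp_block_cons, wp_block_nil, wp_sub, wp_get, St.set_s, if_true, St.set_a, e']
    have hset : ∀ x y z, Ready (((σ'.set .m x).set .c y).set .d z) R L := fun x y z =>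
      ⟨⟨by simp [hR'.consts.zero], by simp [hR'.consts.one], by simp [hR'.consts.five],
        by simp [hR'.consts.seven]⟩, ⟨by simp [hR'.stores.n], hR'.stores.par, hR'.stores.lab⟩,
        by simp [hR'.f], hR'.facts, hR'.inb, hR'.out⟩
    refine ⟨by omega, wp_dispatch (uniform_evalStep rc) L[q] ?_ (by simp [hR'.inb q hq])
      fun x => ?_⟩
    · exact ⟨by simp [hR'.consts.zero], by simp [hR'.consts.one], by simp [hR'.consts.five],
        by simp [hR'.consts.seven]⟩
    · refine (wp_evalStep (l := l) (hset _ _ _) hR (by simp [hR'.inb q hq]) (by simp [htop])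
        (by simpa using hv) hfit'.1).mono ?_
      rintro σ'' t ⟨ht, hS, htop', hv'⟩ t' ht'
      refine ⟨by omega, ?_, by omega, hS.ready (hset _ _ _), htop', hv'⟩
      rw [hS.s _ rfl]
      simp
  · rintro σ' t ⟨ht, -, -, hR', -, hv⟩
    rw [List.drop_zero, hL, foldr_stackStep] at hv
    refine ⟨ht, hR', ?_⟩
    have := hv.1 0 (Nat.zero_lt_of_lt hR.cur_lt)
    simpa using this

/-- No symbol has code 0, so the 0 read past the end of the input marks the end of the sequent. -/
theorem code_pos_or_neg (s : Symb) : 0 < s.code ∨ 0 < -s.code := by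
  cases s with
  | var i => right; simp only [Symb.code]; omega
  | dia α => left; simp only [Symb.code]; split_ifs <;> omega
  | _ => left; simp [Symb.code]

/-- There is one iteration for each symbol and a last one for the end marker, hence `L.length + 1`.
-/
theorem wp_readRight {σ : St} {R : Reader} {L : List Symb} (hσ : Ready σ R [])
    (hm : σ.s .m = 0) (hgo : σ.s .go = 1) (htop : σ.s .top = 0) (hinp : σ.inp = L.map Symb.code) :
    Wp readRight σ fun σ' t => t ≤ (L.length + 1) * 11 + 1 ∧ Ready σ' R L ∧
      σ'.s .m = L.length ∧ σ'.s .top = 0 := by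
  refine (wp_while (v := .go) (fun q σ' => ∃ k, k + q = L.length + 1 ∧
    σ'.s .go = (if q = 0 then 0 else 1) ∧ Ready σ' R (L.take k) ∧
    σ'.s .m = (L.take k).length ∧ σ'.s .top = 0 ∧ σ'.inp = (L.drop k).map Symb.code) 10
    (fun σ' ⟨_, _, h, _⟩ => by simp [h]) ?_ (q := L.length + 1)
    ⟨0, by omega, by simp [hgo], by simpa using hσ, by simp [hm], htop, by simp [hinp]⟩).mono ?_
  · rintro q σ' ⟨k, hk, hgo, hR', hm, htop, hinp⟩
    refine ⟨by rw [hgo]; simp, ?_⟩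
    have hc := hR'.consts
    rcases Nat.eq_zero_or_pos q with rfl | hq
    · have hkL : k = L.length := by omega
      rw [List.drop_eq_nil_of_le (by omega)] at hinp
      simp only [wp_block_cons, wp_block_nil, wp_read, wp_ite, St.set_s, hinp, List.map_nil,
        List.headD_nil, if_true, lt_irrefl, if_false, wp_sub, reduceCtorEq, hc.zero, sub_self,
        wp_const]
      refine ⟨by omega, k + 1, by omega, trivial, ?_, ?_, htop, ?_⟩
      · rw [List.take_of_length_le (by omega)] at hR' ⊢
        exact ⟨⟨by simp [hc.zero], by simp [hc.one], by simp [hc.five], by simp [hc.seven]⟩,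
          ⟨by simp [hR'.stores.n], hR'.stores.par, hR'.stores.lab⟩,
          by simp [hR'.f], hR'.facts, hR'.inb, hR'.out⟩
      · rw [List.take_of_length_le (by omega)] at hm ⊢
        simp [hm]
      · rw [List.drop_eq_nil_of_le (by omega)]; rfl
    · have hkL : k < L.length := by omega
      have hlen : (L.take k).length = k := by simp; omega
      have hlen' : (L.take (k + 1)).length = k + 1 := by simp; omega
      rw [List.drop_eq_getElem_cons hkL] at hinp
      rw [hlen] at hm
      have store : ∀ (σ'' : St) (t : ℕ), t ≤ 6 →
          (∀ v, v ≠ .c → v ≠ .d → σ''.s v = σ'.s v) → σ''.a = σ'.a → σ''.out = σ'.out →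
          σ''.inp = (L.drop (k + 1)).map Symb.code → σ''.s .c = L[k].code →
          Wp (block [.put .inb .m .c, .add .m .m .one]) σ'' fun σ₃ t' => t + t' ≤ 10 ∧
            ∃ k, k + q = L.length + 1 ∧ σ₃.s .go = (if q = 0 then 0 else 1) ∧
            Ready σ₃ R (L.take k) ∧ σ₃.s .m = (L.take k).length ∧ σ₃.s .top = 0 ∧
            σ₃.inp = (L.drop k).map Symb.code := by
        intro σ'' t ht hs ha ho hi hcode
        have hs' : ∀ v, v ≠ .c → v ≠ .d → v ≠ .m → ∀ i x y,
            ((σ''.put .inb i x).set .m y).s v = σ'.s v := fun v h₁ h₂ h₃ i x y => by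
          rw [St.set_s, if_neg h₃, St.put_s, hs v h₁ h₂]
        have hm' : σ''.s .m = k := (hs _ (by decide) (by decide)).trans hm
        simp only [wp_block_cons, wp_block_nil, wp_put, wp_add, hm', Int.toNat_natCast]
        refine ⟨by omega, by omega, k + 1, by omega, ?_, ⟨?_, ⟨?_, ?_, ?_⟩, ?_, ?_, ?_, ?_⟩, ?_, ?_,
          hi⟩
        · rw [hs' _ (by decide) (by decide) (by decide), hgo, if_neg (by omega), if_neg (by omega)]
        · refine ⟨?_, ?_, ?_, ?_⟩ <;> rw [hs' _ (by decide) (by decide) (by decide)]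
          exacts [hc.zero, hc.one, hc.five, hc.seven]
        · rw [hs' _ (by decide) (by decide) (by decide), hR'.stores.n]
        · intro c h₁ h₂
          rw [St.set_a, St.put_a_ne _ _ _ _ _ (by decide), ha]
          exact hR'.stores.par c h₁ h₂
        · intro c h₁ h₂
          rw [St.set_a, St.put_a_ne _ _ _ _ _ (by decide), ha]
          exact hR'.stores.lab c h₁ h₂
        · rw [hs' _ (by decide) (by decide) (by decide), hR'.f]
        · intro i hi
          rw [St.set_a, St.put_a_ne _ _ _ _ _ (by decide), St.put_a_ne _ _ _ _ _ (by decide), ha]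
          exact hR'.facts i hi
        · intro i hi
          rw [St.set_a, St.put_a_self, ha, hcode]
          rw [hlen'] at hi
          rw [List.getElem_take]
          split_ifs with hik
          · subst hik; rfl
          · have := hR'.inb i (by omega)
            rwa [List.getElem_take] at this
        · exact ho.trans hR'.out
        · have h₁ : σ''.s .one = 1 := (hs _ (by decide) (by decide)).trans hc.one
          simp [hm', h₁, hlen']
        · rw [hs' _ (by decide) (by decide) (by decide), htop]
      simp only [wp_block_cons (S := .read .c), wp_read, hinp, List.map_cons, List.headD_cons,
        List.tail_cons, wp_block_cons (S := .ite _ _ _), wp_ite, St.set_s, if_true]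
      rcases code_pos_or_neg L[k] with hpos | hneg
      · rw [if_pos hpos]
        refine Wp.mono (store _ 2 (by omega) (fun v h₁ h₂ => ?_) rfl rfl rfl ?_) ?_
        · simp [h₁]
        · simp
        · rintro σ₃ t ⟨ht, h⟩
          rw [wp_block_nil]
          exact ⟨by omega, h⟩
      · rw [if_neg (by omega)]
        simp only [wp_block_cons (S := .sub .d .zero .c), wp_sub, St.set_s, reduceCtorEq, if_false,
          if_true, hc.zero, zero_sub, wp_block_cons (S := .ite _ _ _), wp_ite, hneg]
        refine Wp.mono (store _ 4 (by omega) (fun v h₁ h₂ => ?_) rfl rfl rfl ?_) ?_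
        · simp [h₁, h₂]
        · simp
        · rintro σ₃ t ⟨ht, h⟩
          simp only [wp_block_nil]
          exact ⟨by omega, h⟩
  · rintro σ' t ⟨ht, k, hk, -, hR', hm, htop, -⟩
    rw [List.take_of_length_le (by omega)] at hR' hm
    exact ⟨ht, hR', hm, htop⟩

end RAM

/-! ### Reading the left-hand side, and the correctness of the decision procedure. -/

namespace RAM

open PosLogic

/-- A stack of nodes, stored from the bottom up. -/
def StackRep (a : ℕ → ℤ) : List ℕ → Prop
  | [] => True
  | x :: l => a l.length = x ∧ StackRep a l

theorem StackRep.congr {a a' : ℕ → ℤ} {l : List ℕ} (h : StackRep a l)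
    (ha : ∀ i < l.length, a' i = a i) : StackRep a' l := by
  induction l with
  | nil => trivial
  | cons x l ih =>
    exact ⟨(ha _ (Nat.lt_succ_self _)).trans h.1, ih h.2 fun i hi => ha i (hi.trans (Nat.lt_succ_self _))⟩

/-- The state `M` of the reader is stored in the state `σ`. -/
structure Reading (σ : St) (M : Reader) : Prop where
  consts : Consts σ
  stores : Stores σ M.tree
  cur : σ.s .cur = M.cur
  sp : σ.s .sp = M.stk.length
  stk : StackRep (σ.a .stk) M.stk
  f : σ.s .f = M.facts.length
  facts : ∀ q (h : q < M.facts.length),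
    σ.a .fv q = (Symb.var M.facts[q].2).code ∧ σ.a .fn q = M.facts[q].1
  m : σ.s .m = 0
  top : σ.s .top = 0
  out : σ.out = []

theorem Reading.set {σ : St} {M : Reader} (h : Reading σ M) {v : Var} {x : ℤ}
    (hv : v = .c ∨ v = .d ∨ v = .go ∨ v = .j) : Reading (σ.set v x) M := by
  obtain ⟨⟨h₁, h₂, h₃, h₄⟩, ⟨h₅, h₆, h₇⟩, h₈, h₉, h₁₀, h₁₁, h₁₂, h₁₃, h₁₄, h₁₅⟩ := h
  rcases hv with rfl | rfl | rfl | rfl <;>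
  exact ⟨⟨by simp [h₁], by simp [h₂], by simp [h₃], by simp [h₄]⟩, ⟨by simp [h₅], h₆, h₇⟩,
    by simp [h₈], by simp [h₉], h₁₀, by simp [h₁₁], h₁₂, by simp [h₁₃], by simp [h₁₄], h₁₅⟩

theorem uniform_readStep : Uniform readStep := ⟨fun _ => rfl, fun _ => rfl⟩

/-- Strings need not be well formed here: on an empty stack the program follows the defaults of
`headD` and `tail` in `Reader.step`. -/
theorem wp_readStep {σ : St} {M : Reader} (hσ : Reading σ M) (hM : M.Good) (s : Symb)
    (hc : σ.s .c = s.code) :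
    Wp (readStep s) σ fun σ' t => t ≤ 8 ∧ Reading σ' (M.step s) ∧ σ'.inp = σ.inp ∧
      (s = .turnstile → σ'.s .go = 0) ∧ (s ≠ .turnstile → σ'.s .go = σ.s .go) := by
  have hσ' := hσ
  obtain ⟨⟨h₁, h₂, h₃, h₄⟩, ⟨h₅, h₆, h₇⟩, h₈, h₉, h₁₀, h₁₁, h₁₂, h₁₃, h₁₄, h₁₅⟩ := hσ'
  cases s with
  | top => exact wp_skip.2 ⟨by omega, hσ, rfl, by simp⟩
  | turnstile =>
    exact wp_const.2 ⟨by omega, hσ.set (.inr (.inr (.inl rfl))), rfl, by simp⟩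
  | var i =>
    simp only [readStep, wp_block_cons, wp_block_nil, wp_put, wp_add, St.put_s, h₁₁,
      Int.toNat_natCast, hc, h₈, h₂]
    refine ⟨by omega, by omega, by omega, ⟨⟨by simp [h₁], by simp [h₂], by simp [h₃], by simp [h₄]⟩,
      ⟨by simp [h₅, Reader.step, Reader.tree], ?_, ?_⟩, by simp [h₈, Reader.step],
      by simp [h₉, Reader.step], ?_, ?_, ?_, by simp [h₁₃], by simp [h₁₄], h₁₅⟩, rfl, by simp⟩
    · intro c hc hn
      simp only [St.set_a, ne_eq, reduceCtorEq, not_false_eq_true, St.put_a_ne]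
      exact h₆ c hc hn
    · intro c hc hn
      simp only [St.set_a, ne_eq, reduceCtorEq, not_false_eq_true, St.put_a_ne]
      exact h₇ c hc hn
    · simp only [St.set_a, ne_eq, reduceCtorEq, not_false_eq_true, St.put_a_ne]
      exact h₁₀
    · simp [Reader.step]
    · intro q hq
      simp only [St.set_a, ne_eq, reduceCtorEq, not_false_eq_true, St.put_a_ne, St.put_a_self]
      simp only [Reader.step, List.length_append, List.length_singleton] at hq ⊢
      rcases Nat.lt_succ_iff_lt_or_eq.1 hq with hq | rfl
      · rw [if_neg hq.ne, if_neg hq.ne, List.getElem_append_left hq]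
        exact h₁₂ q hq
      · simp
  | lpar =>
    simp only [readStep, wp_block_cons, wp_block_nil, wp_put, wp_add, St.put_s, h₉,
      Int.toNat_natCast, h₈, h₂]
    refine ⟨by omega, by omega, ⟨⟨by simp [h₁], by simp [h₂], by simp [h₃], by simp [h₄]⟩,
      ⟨by simp [h₅, Reader.step, Reader.tree], ?_, ?_⟩, by simp [h₈, Reader.step],
      by simp [Reader.step], ?_, by simp [h₁₁, Reader.step], ?_, by simp [h₁₃],
      by simp [h₁₄], h₁₅⟩, rfl, by simp⟩
    · intro c hc hn
      simp only [St.set_a, ne_eq, reduceCtorEq, not_false_eq_true, St.put_a_ne]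
      exact h₆ c hc hn
    · intro c hc hn
      simp only [St.set_a, ne_eq, reduceCtorEq, not_false_eq_true, St.put_a_ne]
      exact h₇ c hc hn
    · refine ⟨by simp, h₁₀.congr fun i hi => ?_⟩
      rw [St.set_a, St.put_a_self, if_neg hi.ne]
    · intro q hq
      simp only [St.set_a, ne_eq, reduceCtorEq, not_false_eq_true, St.put_a_ne]
      exact h₁₂ q hq
  | and =>
    simp only [readStep, wp_ite, wp_block_cons, wp_block_nil, wp_sub, wp_get, wp_const]
    cases hs : M.stk with
    | nil =>
      rw [if_neg (by simp [h₉, hs])]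
      refine ⟨by omega, ⟨⟨by simp [h₁], by simp [h₂], by simp [h₃], by simp [h₄]⟩,
        ⟨by simp [h₅, Reader.step, Reader.tree], h₆, h₇⟩, by simp [Reader.step, hs],
        by simp [h₉, Reader.step], h₁₀, by simp [h₁₁, Reader.step], h₁₂, by simp [h₁₃],
        by simp [h₁₄], h₁₅⟩, rfl, by simp⟩
    | cons x l =>
      have hsp : σ.s .sp = (l.length : ℤ) + 1 := by rw [h₉, hs]; simp
      have hx := h₁₀
      rw [hs] at hx
      rw [if_pos (by omega)]
      simp only [St.set_s, if_true, hsp, h₂, add_sub_cancel_right, Int.toNat_natCast, St.set_a,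
        hx.1]
      refine ⟨by omega, by omega, ⟨⟨by simp [h₁], by simp [h₂], by simp [h₃], by simp [h₄]⟩,
        ⟨by simp [h₅, Reader.step, Reader.tree], h₆, h₇⟩, by simp [Reader.step, hs],
        by simp [h₉, Reader.step], h₁₀, by simp [h₁₁, Reader.step], h₁₂, by simp [h₁₃],
        by simp [h₁₄], h₁₅⟩, rfl, by simp⟩
  | rpar =>
    simp only [readStep, wp_ite, wp_sub, wp_skip]
    cases hs : M.stk with
    | nil =>
      rw [if_neg (by simp [h₉, hs])]
      have hM' : M.step .rpar = M := by
        rcases M with ⟨cur, stk, n, par, lab, facts⟩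
        obtain rfl : stk = [] := hs
        rfl
      exact ⟨by omega, by rwa [hM'], trivial, by simp⟩
    | cons x l =>
      have hsp : σ.s .sp = (l.length : ℤ) + 1 := by rw [h₉, hs]; simp
      rw [hs] at h₁₀
      rw [if_pos (by omega)]
      refine ⟨by omega, ⟨⟨by simp [h₁], by simp [h₂], by simp [h₃], by simp [h₄]⟩,
        ⟨by simp [h₅, Reader.step, Reader.tree], h₆, h₇⟩, by simp [h₈, Reader.step],
        by simp [hsp, h₂, Reader.step, hs], ?_, by simp [h₁₁, Reader.step], h₁₂, by simp [h₁₃],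
        by simp [h₁₄], h₁₅⟩, rfl, by simp⟩
      simpa [Reader.step, hs] using h₁₀.2
  | dia α =>
    have hn' : σ.s .n = M.n := h₅
    simp only [readStep, wp_block_cons, wp_block_nil, wp_put, wp_add, St.put_s, hn',
      Int.toNat_natCast, h₈, h₂, hc, h₁, St.set_s, reduceCtorEq, if_false, add_zero]
    refine ⟨by omega, by omega, by omega,
      ⟨⟨by simp [h₁], by simp [h₂], by simp [h₃], by simp [h₄]⟩,
      ⟨by simp [Reader.step, Reader.tree], ?_, ?_⟩, by simp [Reader.step],
      by simp [h₉, Reader.step], ?_, by simp [h₁₁, Reader.step], ?_, by simp [h₁₃],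
      by simp [h₁₄], h₁₅⟩, rfl, by simp⟩
    · intro c hc hn
      simp only [St.set_a, ne_eq, reduceCtorEq, not_false_eq_true, St.put_a_ne, St.put_a_self]
      split_ifs with hcn
      · simp [Reader.tree, Reader.step, hcn]
      · have hlt : c < M.n := lt_of_le_of_ne (Nat.lt_succ_iff.1 hn) hcn
        rw [h₆ c hc hlt]
        simp [Reader.tree, Reader.step, hcn]
    · intro c hc hn
      simp only [St.set_a, ne_eq, reduceCtorEq, not_false_eq_true, St.put_a_ne, St.put_a_self]
      split_ifs with hcn
      · simp [Reader.tree, Reader.step, hcn]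
      · have hlt : c < M.n := lt_of_le_of_ne (Nat.lt_succ_iff.1 hn) hcn
        rw [h₇ c hc hlt]
        simp [Reader.tree, Reader.step, hcn]
    · simp only [St.set_a, ne_eq, reduceCtorEq, not_false_eq_true, St.put_a_ne]
      exact h₁₀
    · intro q hq
      simp only [St.set_a, ne_eq, reduceCtorEq, not_false_eq_true, St.put_a_ne]
      exact h₁₂ q hq

theorem turnstile_notMem_symbols (A : Formula) : Symb.turnstile ∉ A.symbols := by
  induction A with
  | var i => simp [Formula.symbols]
  | top => simp [Formula.symbols]
  | and A B ihA ihB => simp [Formula.symbols, ihA, ihB]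
  | dia α A ih => simp [Formula.symbols, ih]

/-- The turnstile does not occur in `A`, so the loop stops exactly after `A.length + 1` symbols. The
turnstile leaves the reader unchanged, so the result is the tree of `A`. -/
theorem wp_readLeft {σ : St} {A : Formula} {L : List Symb} (hσ : Reading σ Reader.init)
    (hgo : σ.s .go = 1)
    (hinp : σ.inp = (A.symbols ++ Symb.turnstile :: L).map Symb.code) :
    Wp readLeft σ fun σ' t => t ≤ (A.length + 1) * 26 + 1 ∧ Reading σ' (Reader.ofFormula A) ∧
      σ'.inp = L.map Symb.code := by
  set W := A.symbols ++ Symb.turnstile :: L with hW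
  have hlen : W.length = A.length + 1 + L.length := by
    simp [hW, Formula.length]; omega
  refine (wp_while (v := .go) (fun q σ' => ∃ k, k + q = A.length + 1 ∧
    σ'.s .go = (if q = 0 then 0 else 1) ∧ Reading σ' ((W.take k).foldl Reader.step Reader.init) ∧
    σ'.inp = (W.drop k).map Symb.code) 25
    (fun σ' ⟨_, _, h, _⟩ => by simp [h]) ?_ (q := A.length + 1)
    ⟨0, by omega, by simp [hgo], by simpa using hσ, by simp [hinp]⟩).mono ?_
  · rintro q σ' ⟨k, hk, hgo, hR, hinp⟩
    refine ⟨by rw [hgo]; simp, ?_⟩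
    have hkW : k < W.length := by omega
    rw [List.drop_eq_getElem_cons hkW] at hinp
    set M := (W.take k).foldl Reader.step Reader.init with hM
    have hMg : M.Good := Reader.good_init.foldl _
    have hc₀ : Consts ({ σ'.set .c W[k].code with inp := (W.drop (k + 1)).map Symb.code } : St) :=
      ⟨by simp [hR.consts.zero], by simp [hR.consts.one], by simp [hR.consts.five],
        by simp [hR.consts.seven]⟩
    have hread : ∀ e, Reading
        (({ σ'.set .c W[k].code with inp := (W.drop (k + 1)).map Symb.code } : St).set .d e) M := by
      intro e
      have := hR.set (v := .c) (x := W[k].code) (.inl rfl)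
      exact Reading.set (σ := { σ'.set .c W[k].code with inp := (W.drop (k + 1)).map Symb.code })
        ⟨⟨hc₀.zero, hc₀.one, hc₀.five, hc₀.seven⟩, ⟨this.stores.n, this.stores.par, this.stores.lab⟩, this.cur,
        this.sp, this.stk, this.f, this.facts, this.m, this.top, this.out⟩ (.inr (.inl rfl))
    simp only [wp_block_cons, wp_block_nil, wp_read, hinp, List.map_cons, List.headD_cons,
      List.tail_cons]
    refine wp_dispatch uniform_readStep W[k] hc₀ (by simp) fun e =>
      (wp_readStep (hread e) hMg W[k] (by simp)).mono ?_
    rintro σ'' t ⟨ht, hR', hi, hg⟩ t' ht'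
    refine ⟨by omega, k + 1, by omega, ?_, ?_, ?_⟩
    · have hgo' : σ'.s .go = 1 := by rw [hgo, if_neg (by omega)]
      rcases Nat.eq_zero_or_pos q with rfl | hq
      · have : W[k] = Symb.turnstile := by
          simp only [hW]
          rw [List.getElem_append_right (by simp only [Formula.length] at hk; omega)]
          simp only [Formula.length] at hk
          simp [show k - A.symbols.length = 0 by omega]
        rw [hg.1 this, if_pos rfl]
      · have hkA : k < A.symbols.length := by simp only [Formula.length] at hk; omega
        have hne : W[k] ≠ Symb.turnstile := by
          simp only [hW]
          rw [List.getElem_append_left hkA]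
          exact fun h => turnstile_notMem_symbols A (h ▸ List.getElem_mem hkA)
        rw [hg.2 hne, if_neg (by omega), ← hgo']
        simp
    · rw [List.take_succ_eq_append_getElem hkW, List.foldl_append]
      exact hR'
    · rw [hi]; rfl
  · rintro σ' t ⟨ht, k, hk, -, hR, hinp⟩
    obtain rfl : k = A.length + 1 := by omega
    have h₁ : W.take (A.length + 1) = A.symbols ++ [Symb.turnstile] := by
      simp [hW, Formula.length, List.take_append]
    have h₂ : W.drop (A.length + 1) = L := by
      simp [hW, Formula.length, List.drop_append]
    rw [h₁, List.foldl_append] at hR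
    rw [h₂] at hinp
    exact ⟨ht, hR, hinp⟩

theorem _root_.PosLogic.Formula.length_pos (A : Formula) : 0 < A.length := by
  cases A <;> simp [Formula.length, Formula.symbols]

/-- Both lengths are positive, so the linear and constant costs of the reading phases are absorbed
by the product. -/
theorem decider_spec (rc : Bool) (A B : Formula) :
    ∃ σ t, Exec (decider rc) (St.init (sequentInput A B)) σ t ∧
      t ≤ 1000 * (A.length * B.length) ∧
      (Prov rc A B → σ.out = [1]) ∧ (¬ Prov rc A B → σ.out = [0]) := by
  suffices h : Wp (decider rc) (St.init (sequentInput A B)) fun σ t =>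
      t ≤ 1000 * (A.length * B.length) ∧
      (Prov rc A B → σ.out = [1]) ∧ (¬ Prov rc A B → σ.out = [0]) from h
  simp only [decider, wp_block_cons, wp_block_nil, wp_const]
  refine Wp.mono (wp_readLeft (A := A) (L := B.symbols) ?_ ?_ ?_) ?_
  · refine ⟨⟨?_, ?_, ?_, ?_⟩, ⟨?_, fun c h₁ h₂ => ?_, fun c h₁ h₂ => ?_⟩, ?_, ?_, trivial, ?_, ?_, ?_,
      ?_, rfl⟩
    any_goals simp [St.init, Reader.init, Reader.tree]
    all_goals
      simp only [Reader.init, Reader.tree] at h₂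
      omega
  · simp
  · simp [St.init, sequentInput]
  rintro σ₁ t₁ ⟨ht₁, hR₁, hi₁⟩
  set R := Reader.ofFormula A with hR
  refine Wp.mono (wp_readRight (R := R) (L := B.symbols) ?_ ?_ ?_ ?_ ?_) ?_
  · have := hR₁.set (v := .go) (x := 1) (.inr (.inr (.inl rfl)))
    exact ⟨this.consts, this.stores, this.f, this.facts, fun q h => by simp at h, this.out⟩
  · simp [hR₁.m]
  · simp
  · simp [hR₁.top]
  · exact hi₁
  rintro σ₂ t₂ ⟨ht₂, hR₂, hm₂, htop₂⟩
  refine (wp_evalRight (rc := rc) hR₂ (Reader.good_ofFormula A) hm₂ htop₂).mono ?_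
  rintro σ₃ t₃ ⟨ht₃, hR₃, hsat⟩
  rw [← Reader.prov_iff_sat] at hsat
  have hsize : R.n + R.facts.length ≤ 1 + A.length := by
    have := Reader.size_foldl Reader.init A.symbols
    exact this
  have htime : t₁ + t₂ + t₃ + 20 ≤ 1000 * (A.length * B.length) := by
    have ha := A.length_pos
    have hb := B.length_pos
    have h₁ : B.length * (100 * (R.n + R.facts.length) + 25) ≤
        B.length * (100 * (1 + A.length) + 25) := Nat.mul_le_mul_left _ (by omega)
    have h₂ : A.length ≤ A.length * B.length := Nat.le_mul_of_pos_right _ hb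
    have h₃ : B.length ≤ A.length * B.length := Nat.le_mul_of_pos_left _ ha
    have h₄ : B.length * (100 * (1 + A.length) + 25) = 100 * (A.length * B.length) + 125 * B.length := by
      ring
    have h₅ : B.symbols.length = B.length := rfl
    omega
  simp only [wp_get, hR₃.consts.zero, wp_ite, wp_print, St.set_s, if_true, Int.toNat_zero,
    reduceCtorEq, if_false, St.set_out, hR₃.out, hR₃.consts.one, List.nil_append]
  refine ⟨le_rfl, ?_⟩
  by_cases h : Prov rc A B
  · rw [if_pos (hsat.2 h)]
    exact ⟨by omega, fun _ => trivial, fun h' => absurd h h'⟩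
  · rw [if_neg (mt hsat.1 h)]
    exact ⟨by omega, fun h' => absurd h' h, fun _ => trivial⟩

theorem exists_decidesInTime (rc : Bool) : ∃ (P : Program) (C : ℕ),
    ∀ T : Formula → Formula → ℕ, (∀ A B : Formula, C * (A.length * B.length) ≤ T A B) →
      DecidesInTime P (Prov rc) T := by
  -- The time bound 1000 of `decider_spec` is multiplied by the slowdown 8 of the compilation.
  refine ⟨(decider rc).compile 0, 8000, fun T hT A B => ?_⟩
  obtain ⟨σ, t, he, ht, h₁, h₀⟩ := decider_spec rc A B
  obtain ⟨t', ht', hh⟩ := he.haltsWith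
  refine ⟨t', le_trans (by omega) (hT A B), fun h => ?_, fun h => ?_⟩
  · rwa [h₁ h] at hh
  · rwa [h₀ h] at hh

end RAM

theorem mainTheorem9 :
    (∃ (P : RAM.Program) (C : ℕ),
      RAM.DecidesInTime P PosLogic.RJ (fun A B => C * (A.length ^ 2 * B.length)) ∧
      RAM.DecidesInTime P PosLogic.RJ (fun A B => C * (A.length + B.length) ^ 3)) ∧
    (∃ (P : RAM.Program) (C : ℕ),
      RAM.DecidesInTime P PosLogic.RC (fun A B =>
        C * (A.length ^ 2 * max 1 (A.modalities ∪ B.modalities).card * B.length)) ∧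
      RAM.DecidesInTime P PosLogic.RC (fun A B => C * (A.length + B.length) ^ 4)) := by
  -- All the bounds follow from O(|A|·|B|), since formulas are nonempty strings and `max 1 _` is
  -- positive.
  have hsq : ∀ A : PosLogic.Formula, A.length ≤ A.length ^ 2 := fun A => by
    rw [pow_two]; exact Nat.le_mul_of_pos_left _ A.length_pos
  have hpow : ∀ (A B : PosLogic.Formula) (k : ℕ),
      A.length * B.length ≤ (A.length + B.length) ^ (k + 2) := fun A B k => by
    have h : 0 < A.length + B.length := Nat.add_pos_left A.length_pos _
    calc A.length * B.length ≤ (A.length + B.length) * (A.length + B.length) :=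
          Nat.mul_le_mul (by omega) (by omega)
      _ = (A.length + B.length) ^ 2 := (pow_two _).symm
      _ ≤ _ := Nat.pow_le_pow_right h (by omega)
  constructor
  · obtain ⟨P, C, h⟩ := RAM.exists_decidesInTime false
    exact ⟨P, C, h _ fun A B => Nat.mul_le_mul_left _ (Nat.mul_le_mul_right _ (hsq A)),
      h _ fun A B => Nat.mul_le_mul_left _ (hpow A B 1)⟩
  · obtain ⟨P, C, h⟩ := RAM.exists_decidesInTime true
    refine ⟨P, C, h _ fun A B => Nat.mul_le_mul_left _ (Nat.mul_le_mul_right _ ?_),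
      h _ fun A B => Nat.mul_le_mul_left _ (hpow A B 2)⟩
    exact (hsq A).trans (Nat.le_mul_of_pos_right _ (by positivity))
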